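/- **Network.** There are $K_T$ single-antenna transmitters, $K_R\ge 1$ single-antenna receivers and a library of $N\ge 1$ files of $F$ packets each. Every transmitter caches a set $\mathcal P_i$ of at most $\mu_T N F$ packets and every receiver a set $\mathcal U_j$ of at most $\mu_R N F$ packets (uncoded), where $\mu_T\le 1$, $0\le\mu_R<1$, and $K_T\mu_T\ge 1$ is an integer. The channel consists of two parallel subchannels of normalized capacities $\alpha\in[0,1]$ and $\bar\alpha=1-\alpha$, whose coefficient matrices in each channel use have absolutely continuous laws; the transmitters know the first matrix perfectly (P-subchannel) and do not know the second (N-subchannel). The receivers know both. **Delivery.** After demands $\mathbf d\in[N]^{K_R}$ are revealed, $\mathcal D$ is the set of pairs $(j,w)$ with $w$ a packet of file $d_j$ not in $\mathcal U_j$ (a missing packet is counted once for each receiver that requests it). Each packet is split, with ratio $q:(1-q)$, into a P-subpacket and an N-subpacket, sent over the two subchannels in $H^{(p)}$ and $H^{(n)}$ blocks. In a block, distinct packets are delivered to distinct receivers, one each: every packet is beamformed (with power constraint $1$ at each transmitter) by transmitters that cache it, and each scheduled receiver must be able, almost surely, to cancel all other packets of the block by a linear combination of its received symbol and of the symbols of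 its cached packets, keeping the desired one. The beamformers may depend on the channel on the P-subchannel and may not on the N-subchannel. All pairs in $\mathcal D$ must be served on both subchannels. The delivery time is $H=\max\{\frac q\alpha H^{(p)},\frac{1-q}{\bar\alpha}H^{(n)}\}$ (where $0/0=0$ and $x/0=\infty$ for $x>0$). The one-shot linear DoF of $(\{\mathcal P_i\},\{\mathcal U_j\},q)$ is the infimum over demands with $\mathcal D\neq\emptyset$ of the supremum of $|\mathcal D|/H$ over all delivery schedules, and the one-shot linear DoF of the network, $\mathsf{DoF}^*_{L}(\mu_T,\mu_R,\alpha)$, is its supremum over all (coordinated) cache placements and all $q\in[0,1]$. **Theorem.** Let $$\mathsf{DoF}_{L,D}(\mu_T,\mu_R,\alpha)=\alpha\cdot\frac{1}{\sum_{l=0}^{K_R-1}\frac{\binom{K_R-1}{l}\mu_R^l(1-\mu_R)^{K_R-l-1}}{\min\{K_T\mu_T+l,\,K_R\}}}+\bar\alpha\cdot\frac{K_R\mu_R}{1-(1-\mu_R)^{K_R}},$$ where the last fraction is read as its limit $1$ at $\mu_R=0$. 1. $\mathsf{DoF}_{L,D}$ is achievable with centralized placement at the transmitters and random decentralized placement at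 the receivers: there are a splitting ratio $q$ and transmitter placements for every $F$ such that, when each receiver independently caches a uniformly random set of $\lfloor\mu_R F\rfloor$ packets of each file, for every $\varepsilon>0$ the one-shot linear DoF of the resulting caching realization is at least $\mathsf{DoF}_{L,D}-\varepsilon$ with probability tending to $1$ as $F\to\infty$ (through the values for which $\mu_T N F$ is an integer). 2. For every $F\ge 1$, $\mathsf{DoF}_{L,D}(\mu_T,\mu_R,\alpha)\ \ge\ \frac13\,\mathsf{DoF}^*_{L}(\mu_T,\mu_R,\alpha)$. -/

import Mathlib

open MeasureTheory Filter Topology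
open scoped ENNReal BigOperators

noncomputable section

namespace CacheNet

/-- A packet `w = (n, f)`: the `f`-th packet of the `n`-th file, `N` files of `F` packets each. -/
abbrev Packet (N F : ℕ) : Type := Fin N × Fin F

/-- A delivery request `(j, w)`: packet `w` has to be delivered to receiver `j`. -/
abbrev Request (KR N F : ℕ) : Type := Fin KR × Packet N F

/-- The channel coefficients of one subchannel in one channel use:
`h j i` is the coefficient from transmitter `i` to receiver `j`. -/
abbrev Channel (KT KR : ℕ) : Type := Fin KR → Fin KT → ℂ

/-- The beamforming coefficients of one channel use:
`v i w` is the coefficient with which transmitter `i` sends the symbol of packet `w`. -/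
abbrev Beamformer (KT N F : ℕ) : Type := Fin KT → Packet N F → ℂ

section Delivery

variable {KT KR N F : ℕ}

open Classical in
/-- All deliveries needed for the demands `d` and the receiver caches `U`: the pairs `(j, w)`
with `w` a packet of the file `d j` that receiver `j` has not cached. -/
def requests (d : Fin KR → Fin N) (U : Fin KR → Finset (Packet N F)) :
    Finset (Request KR N F) :=
  Finset.univ.filter fun r => r.2.1 = d r.1 ∧ r.2 ∉ U r.1

open Classical in
/-- The coefficient with which the symbol of packet `w` arrives at receiver `j`, when it is sent
jointly by all the transmitters that have cached `w`. -/
def gain (P : Fin KT → Finset (Packet N F)) (h : Channel KT KR) (v : Beamformer KT N F)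
    (j : Fin KR) (w : Packet N F) : ℂ :=
  ∑ i ∈ Finset.univ.filter (fun i => w ∈ P i), h j i * v i w

open Classical in
/-- The unit transmit power constraint at every transmitter, for the block that serves the
requests `S` (the coded symbols of different packets are uncorrelated and of unit power). -/
def PowerConstraint (P : Fin KT → Finset (Packet N F)) (S : Finset (Request KR N F))
    (v : Beamformer KT N F) : Prop :=
  ∀ i, ∑ r ∈ S.filter (fun r => r.2 ∈ P i), ‖v i r.2‖ ^ 2 ≤ 1

open Classical in
/-- Linear decodability in one channel use of the block that serves the requests `S`: for each
`(j, w) ∈ S`, receiver `j` has a linear combination, with coefficient `a` on its received symbol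
and coefficients `b` on the symbols of its cached packets, which leaves the symbol of `w` (plus
noise) and cancels the symbols of all the other packets sent in the block. -/
def Decodable (P : Fin KT → Finset (Packet N F)) (U : Fin KR → Finset (Packet N F))
    (S : Finset (Request KR N F)) (h : Channel KT KR) (v : Beamformer KT N F) : Prop :=
  ∀ r ∈ S, ∃ (a : ℂ) (b : Packet N F → ℂ), ∀ s ∈ S,
    a * gain P h v r.1 s.2 + (if s.2 ∈ U r.1 then b s.2 else 0) = if s.2 = r.2 then 1 else 0

/-- A block on the subchannel with perfect CSIT can serve the requests `S`:
the beamformer may depend on the channel realization. -/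
def FeasibleP (ν : Measure (Channel KT KR)) (P : Fin KT → Finset (Packet N F))
    (U : Fin KR → Finset (Packet N F)) (S : Finset (Request KR N F)) : Prop :=
  ∀ᵐ h ∂ν, ∃ v : Beamformer KT N F, PowerConstraint P S v ∧ Decodable P U S h v

/-- A block on the subchannel without CSIT can serve the requests `S`:
the beamformer must not depend on the channel realization. -/
def FeasibleN (ν : Measure (Channel KT KR)) (P : Fin KT → Finset (Packet N F))
    (U : Fin KR → Finset (Packet N F)) (S : Finset (Request KR N F)) : Prop :=
  ∃ v : Beamformer KT N F, PowerConstraint P S v ∧ ∀ᵐ h ∂ν, Decodable P U S h v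

/-- `B` is a schedule of `H` blocks for the requests `D`: in every block the scheduled receivers
are distinct and so are the packets (each packet is intended for exactly one receiver), every
block is feasible, and every request is served in some block. -/
def IsSchedule (feasible : Finset (Request KR N F) → Prop) (D : Finset (Request KR N F))
    (H : ℕ) (B : Fin H → Finset (Request KR N F)) : Prop :=
  (∀ m, B m ⊆ D ∧ Set.InjOn Prod.fst (B m : Set (Request KR N F)) ∧
    Set.InjOn Prod.snd (B m : Set (Request KR N F)) ∧ feasible (B m)) ∧
  ∀ r ∈ D, ∃ m, r ∈ B m

/-- The delivery time `max {(q/α) Hp, ((1-q)/(1-α)) Hn}` in time-slots. In `ℝ≥0∞` a subchannel of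
zero bandwidth takes no time if it carries nothing (`0 / 0 = 0`) and infinite time otherwise. -/
def deliveryTime (α q : ℝ) (Hp Hn : ℕ) : ℝ≥0∞ :=
  max (ENNReal.ofReal q / ENNReal.ofReal α * Hp)
    (ENNReal.ofReal (1 - q) / ENNReal.ofReal (1 - α) * Hn)

/-- The maximal one-shot linear DoF, for worst-case demands, of a fixed caching realization
`(P, U)` and splitting ratio `q`. Demands which leave nothing to deliver impose no constraint. -/
def realizationDoF (α : ℝ) (νp νn : Measure (Channel KT KR)) (P : Fin KT → Finset (Packet N F))
    (U : Fin KR → Finset (Packet N F)) (q : ℝ) : ℝ≥0∞ :=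
  ⨅ (d : Fin KR → Fin N) (_ : (requests d U).Nonempty),
    ⨆ (Hp : ℕ) (Hn : ℕ) (Bp : Fin Hp → Finset (Request KR N F))
      (Bn : Fin Hn → Finset (Request KR N F))
      (_ : IsSchedule (FeasibleP νp P U) (requests d U) Hp Bp)
      (_ : IsSchedule (FeasibleN νn P U) (requests d U) Hn Bn),
      ((requests d U).card : ℝ≥0∞) / deliveryTime α q Hp Hn

end Delivery

/-- The one-shot linear DoF of the network: the supremum over all (centralized) caching
realizations that respect the memory sizes and over all splitting ratios. -/
def networkDoF (KT KR N F : ℕ) (μT μR α : ℝ) (νp νn : Measure (Channel KT KR)) : ℝ≥0∞ :=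
  ⨆ (P : Fin KT → Finset (Packet N F)) (U : Fin KR → Finset (Packet N F)) (q : ℝ)
    (_ : ∀ i, ((P i).card : ℝ) ≤ μT * N * F) (_ : ∀ j, ((U j).card : ℝ) ≤ μR * N * F)
    (_ : 0 ≤ q ∧ q ≤ 1), realizationDoF α νp νn P U q

/-- All outcomes of the receivers' choices when each receiver `j` picks, from each file `n`, a set
`s j n` of `⌊μR F⌋` of its `F` packets. -/
def receiverChoices (KR N F : ℕ) (μR : ℝ) : Finset (Fin KR → Fin N → Finset (Fin F)) :=
  Fintype.piFinset fun _ => Fintype.piFinset fun _ =>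
    Finset.powersetCard ⌊μR * F⌋₊ (Finset.univ : Finset (Fin F))

/-- The receiver caches that result from the choices `s`. -/
def cacheOf {KR N F : ℕ} (s : Fin KR → Fin N → Finset (Fin F)) (j : Fin KR) :
    Finset (Packet N F) :=
  Finset.univ.filter fun w => w.2 ∈ s j w.1

open Classical in
/-- The probability of an event under decentralized placement: all receivers, for all files, make
their choices independently and uniformly at random, that is, the joint choice is uniform on the
product set `receiverChoices`. -/
def decentralizedProb (KR N F : ℕ) (μR : ℝ)
    (E : (Fin KR → Finset (Packet N F)) → Prop) : ℝ :=
  (((receiverChoices KR N F μR).filter fun s => E (cacheOf s)).card : ℝ) /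
    ((receiverChoices KR N F μR).card : ℝ)

/-- `δ` is achievable with centralized placement at the transmitters and random decentralized
placement at the receivers: there are a splitting ratio `q` and transmitter placements `P F` within
the memory size such that, as the number `F` of packets per file grows (through the values for
which the transmitter memory `μT N F` is a whole number of packets), the DoF of the random caching
realization, for worst-case demands, exceeds `δ - ε` with probability tending to one, for every
`ε > 0`. -/
def DecentralizedAchievable (KT KR N : ℕ) (μT μR α : ℝ) (νp νn : Measure (Channel KT KR))
    (δ : ℝ) : Prop :=
  ∃ q : ℝ, 0 ≤ q ∧ q ≤ 1 ∧
    ∃ P : (F : ℕ) → Fin KT → Finset (Packet N F),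
      (∀ F i, ((P F i).card : ℝ) ≤ μT * N * F) ∧
      ∀ ε : ℝ, 0 < ε →
        Tendsto
          (fun F : ℕ => decentralizedProb KR N F μR fun U =>
            ENNReal.ofReal (δ - ε) ≤ realizationDoF α νp νn (P F) U q)
          (atTop ⊓ 𝓟 {F : ℕ | ∃ a : ℕ, μT * N * F = a}) (𝓝 1)

/-- The DoF under decentralized placement:
`α / ∑_{l<KR} (C(KR-1,l) μR^l (1-μR)^(KR-l-1) / min {KT μT + l, KR})
  + (1-α) KR μR / (1 - (1-μR)^KR)`,
where the last fraction is replaced by its limit `1` at `μR = 0`. -/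
def decentralizedDoF (KT KR : ℕ) (μT μR α : ℝ) : ℝ :=
  α * (1 / ∑ l ∈ Finset.range KR,
      (((KR - 1).choose l : ℝ) * μR ^ l * (1 - μR) ^ (KR - l - 1)) /
        min ((KT : ℝ) * μT + l) (KR : ℝ)) +
    (1 - α) * (if μR = 0 then 1 else (KR : ℝ) * μR / (1 - (1 - μR) ^ KR))

end CacheNet

end

/-! Almost every channel matrix has only nonzero minors, and feasibility of a block then becomes a
matter of counting. With perfect CSIT, a packet held by t transmitters can be nulled at t - 1
receivers without being lost at its destination, and at no more; receivers that cache it need no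
nulling. Without CSIT, a fixed nonzero beamformer is heard by every receiver, so all other scheduled
receivers must cache the packet. A block containing a packet cached at t transmitters and r
receivers thus serves at most min(K_R, t + r) requests on the P-subchannel and 1 + r on the
N-subchannel (`card_le_of_feasibleP`, `card_le_of_feasibleN`).

Converse. Charge every request the reciprocal of the size of a block serving it; the total charge is
at most the number of blocks. Averaging over the demands in which all receivers want the same file
weights a packet by the number of receivers lacking it, and the memory constraints bound the
weighted mean block sizes by c = min(K_R, K_T μ_T/(1-μ_R) + K_R μ_R) and b = 1 + K_R μ_R. Replacing
1/s by a tangent line makes the convexity argument linear, so a single demand can be extracted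
(`exists_demand`). For every q one subchannel is the bottleneck, whence DoF ≤ αc + (1-α)b
(`realizationDoF_le`). Each of c, b is at most three times its counterpart in the formula
(`blockBoundP_le`, `one_add_le_three_mul`).

Achievability. By Chebyshev's inequality and a union bound, with high probability no set L of
receivers is the exact set of cachers of many more than F μ_R^|L| (1-μ_R)^(K_R-|L|) packets of a
file (`le_decentralizedProb`). Requests are treated separately for each number l of cachers. Without
CSIT, coded multicasting serves l + 1 receivers per block (`exists_scheduleN`). With CSIT, one
template block of min(K_T μ_T + l, K_R) receivers is moved by all permutations of the receivers, so
that by symmetry every kind of request is served equally often (`exists_scheduleP`). Up to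
lower-order terms the block counts are F K_R (1-μ_R) divided by the respective term of the formula,
and q is chosen so that both subchannels finish together. -/

namespace CacheNet

/-! ### Generic channel matrices and zero-forcing -/

section Generic

variable {KT KR N F : ℕ}

instance : (volume : Measure (Channel KT KR)).IsAddHaarMeasure :=
  MeasureTheory.Measure.pi.isAddHaarMeasure _

/-- All minors of the channel matrix are nonzero. -/
def IsGeneric (h : Channel KT KR) : Prop :=
  ∀ (n : ℕ) (r : Fin n ↪ Fin KR) (c : Fin n ↪ Fin KT),
    (Matrix.of fun a b => h (r a) (c b)).det ≠ 0

/-- In the direction of the partial permutation matrix with ones at the positions (r a, c a), the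
submatrix H moves as H + tI. Its determinant is the characteristic polynomial of -H at t, which is
monic and so has finitely many roots. Every line in this direction meets the exceptional set in a
null set. -/
theorem ae_minor_ne_zero (n : ℕ) (r : Fin n ↪ Fin KR) (c : Fin n ↪ Fin KT) :
    ∀ᵐ h : Channel KT KR, (Matrix.of fun a b => h (r a) (c b)).det ≠ 0 := by
  classical
  let x₀ : Channel KT KR := fun j i => if ∃ a, r a = j ∧ c a = i then 1 else 0
  let s : Set (Channel KT KR) := {h | (Matrix.of fun a b => h (r a) (c b)).det ≠ 0}
  have hs : IsOpen s := by
    apply isOpen_ne_fun _ continuous_const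
    apply Continuous.matrix_det
    fun_prop
  have key : ∀ y : Channel KT KR,
      ∀ᵐ t : ℂ, y + (LinearMap.toSpanSingleton ℂ (Channel KT KR) x₀) t ∈ s := by
    intro y
    let H : Matrix (Fin n) (Fin n) ℂ := Matrix.of fun a b => y (r a) (c b)
    have hfin : {t : ℂ | (-H).charpoly.IsRoot t}.Finite :=
      Polynomial.finite_setOfPred_isRoot (Matrix.charpoly_monic _).ne_zero
    have h0 := hfin.measure_zero volume
    rw [measure_eq_zero_iff_ae_notMem] at h0
    filter_upwards [h0] with t ht
    simp only [Polynomial.IsRoot, Matrix.eval_charpoly] at ht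
    simp only [s, Set.mem_ofPred_eq]
    convert ht using 2
    ext a b
    by_cases hab : a = b
    · subst hab
      simp [x₀, H, add_comm]
    · simp [x₀, H, hab]
  exact ae_mem_of_ae_add_linearMap_mem _ volume volume hs.measurableSet key

theorem ae_isGeneric : ∀ᵐ h : Channel KT KR, IsGeneric h := by
  simp only [IsGeneric, ae_all_iff]
  exact fun n r c => ae_minor_ne_zero n r c

theorem IsGeneric.det_ne_zero {h : Channel KT KR} (hh : IsGeneric h) {n : ℕ}
    {r : Fin n → Fin KR} {c : Fin n → Fin KT} (hr : Function.Injective r)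
    (hc : Function.Injective c) : (Matrix.of fun a b => h (r a) (c b)).det ≠ 0 :=
  hh n ⟨r, hr⟩ ⟨c, hc⟩

theorem IsGeneric.ne_zero {h : Channel KT KR} (hh : IsGeneric h) (j : Fin KR) (i : Fin KT) :
    h j i ≠ 0 := by
  simpa using hh.det_ne_zero (n := 1) (r := fun _ => j) (c := fun _ => i)
    (Function.injective_of_subsingleton _) (Function.injective_of_subsingleton _)

theorem sum_finset_eq_sum_emb {n : ℕ} {T : Finset (Fin KT)} (e : Fin n ≃ T) (f : Fin KT → ℂ) :
    ∑ i ∈ T, f i = ∑ b, f (e b) := by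
  rw [← Finset.sum_coe_sort, ← e.sum_comp]

/-- A generic channel has no nonzero beamformer supported on `T` which is nulled at `T.card`
receivers. -/
theorem IsGeneric.eq_zero_of_null {h : Channel KT KR} (hh : IsGeneric h) {T : Finset (Fin KT)}
    {Z : Finset (Fin KR)} (hTZ : T.card ≤ Z.card) {v : Fin KT → ℂ}
    (hv : ∀ z ∈ Z, ∑ i ∈ T, h z i * v i = 0) : ∀ i ∈ T, v i = 0 := by
  obtain ⟨Z', hZ', hcard⟩ := Finset.exists_subset_card_eq hTZ
  let e := (T.equivFin).symm
  let g := (Z'.equivFinOfCardEq hcard).symm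
  let A : Matrix (Fin T.card) (Fin T.card) ℂ :=
    Matrix.of fun a b => h (g a) (e b)
  have hA : A.det ≠ 0 := hh.det_ne_zero (Subtype.val_injective.comp g.injective)
    (Subtype.val_injective.comp e.injective)
  have hmul : A.mulVec (fun b => v (e b)) = 0 := by
    ext a
    have := hv (g a) (hZ' (g a).2)
    rw [sum_finset_eq_sum_emb e] at this
    simpa [A, Matrix.mulVec, dotProduct] using this
  have := Matrix.eq_zero_of_mulVec_eq_zero hA hmul
  intro i hi
  have h2 := congrFun this (e.symm ⟨i, hi⟩)
  simpa using h2

/-- On a generic channel, a packet cached by more than `Z.card` transmitters can be zero-forced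
at the receivers in `Z` without being lost at receiver `j`. -/
theorem IsGeneric.exists_zeroForcing {h : Channel KT KR} (hh : IsGeneric h) {T : Finset (Fin KT)}
    {Z : Finset (Fin KR)} {j : Fin KR} (hj : j ∉ Z) (hTZ : Z.card < T.card) :
    ∃ v : Fin KT → ℂ, ∑ i ∈ T, h j i * v i ≠ 0 ∧ ∀ z ∈ Z, ∑ i ∈ T, h z i * v i = 0 := by
  classical
  have hle : (insert j Z).card ≤ T.card := by
    rw [Finset.card_insert_of_notMem hj]; omega
  obtain ⟨T', hT', hcard⟩ := Finset.exists_subset_card_eq hle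
  let e := (T'.equivFinOfCardEq hcard).symm
  let g := ((insert j Z).equivFin).symm
  let A : Matrix (Fin (insert j Z).card) (Fin (insert j Z).card) ℂ :=
    Matrix.of fun a b => h (g a) (e b)
  have hA : A.det ≠ 0 := hh.det_ne_zero (Subtype.val_injective.comp g.injective)
    (Subtype.val_injective.comp e.injective)
  let x := A⁻¹.mulVec fun a => if (g a : Fin KR) = j then 1 else 0
  have hx : A.mulVec x = fun a => if (g a : Fin KR) = j then 1 else 0 := by
    simp only [x, Matrix.mulVec_mulVec]
    rw [Matrix.mul_nonsing_inv _ (isUnit_iff_ne_zero.mpr hA), Matrix.one_mulVec]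
  let v : Fin KT → ℂ := fun i => if hi : i ∈ T' then x (e.symm ⟨i, hi⟩) else 0
  have hsum : ∀ z (hz : z ∈ insert j Z), ∑ i ∈ T, h z i * v i = if z = j then 1 else 0 := by
    intro z hz
    have h1 : ∑ i ∈ T', h z i * v i = ∑ i ∈ T, h z i * v i :=
      Finset.sum_subset hT' fun i _ hi => by simp [v, hi]
    rw [← h1, sum_finset_eq_sum_emb e]
    have := congrFun hx (g.symm ⟨z, hz⟩)
    simpa [A, Matrix.mulVec, dotProduct, v] using this
  refine ⟨v, ?_, fun z hz => ?_⟩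
  · rw [hsum j (Finset.mem_insert_self _ _)]; simp
  · rw [hsum z (Finset.mem_insert_of_mem hz), if_neg]
    rintro rfl; exact hj hz

end Generic

/-! ### Which blocks are feasible on each subchannel -/

section Blocks

variable {KT KR N F : ℕ}

open Classical in
/-- The transmitters that cache the packet `w`. -/
def transmitters (P : Fin KT → Finset (Packet N F)) (w : Packet N F) : Finset (Fin KT) :=
  Finset.univ.filter fun i => w ∈ P i

open Classical in
/-- The receivers that cache the packet `w`. -/
def cachers (U : Fin KR → Finset (Packet N F)) (w : Packet N F) : Finset (Fin KR) :=
  Finset.univ.filter fun j => w ∈ U j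

theorem mem_transmitters {P : Fin KT → Finset (Packet N F)} {w : Packet N F} {i : Fin KT} :
    i ∈ transmitters P w ↔ w ∈ P i := by simp [transmitters]

theorem mem_cachers {U : Fin KR → Finset (Packet N F)} {w : Packet N F} {j : Fin KR} :
    j ∈ cachers U w ↔ w ∈ U j := by simp [cachers]

theorem mem_requests {d : Fin KR → Fin N} {U : Fin KR → Finset (Packet N F)}
    {r : Request KR N F} : r ∈ requests d U ↔ r.2.1 = d r.1 ∧ r.2 ∉ U r.1 := by
  simp [requests]

theorem gain_eq (P : Fin KT → Finset (Packet N F)) (h : Channel KT KR) (v : Beamformer KT N F)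
    (j : Fin KR) (w : Packet N F) :
    gain P h v j w = ∑ i ∈ transmitters P w, h j i * v i w := by
  simp only [gain, transmitters]

/-- Any beamformer can be scaled down to satisfy the power constraint. -/
theorem exists_powerConstraint_smul (P : Fin KT → Finset (Packet N F))
    (S : Finset (Request KR N F)) (v : Beamformer KT N F) :
    ∃ c : ℂ, c ≠ 0 ∧ PowerConstraint P S (fun i w => c * v i w) := by
  classical
  -- The summand 1 gives M ≥ 1; scaling by 1/M leaves power at most M / M² ≤ 1.
  let M : ℝ := 1 + ∑ i, ∑ r ∈ S, ‖v i r.2‖ ^ 2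
  have hM : 1 ≤ M := le_add_of_nonneg_right (by positivity)
  have hM0 : 0 < M := by linarith
  refine ⟨((M⁻¹ : ℝ) : ℂ), by exact_mod_cast (inv_pos.mpr hM0).ne', fun i => ?_⟩
  have h1 : ∑ r ∈ S.filter (fun r => r.2 ∈ P i), ‖v i r.2‖ ^ 2 ≤ M := by
    calc _ ≤ ∑ r ∈ S, ‖v i r.2‖ ^ 2 :=
          Finset.sum_le_sum_of_subset_of_nonneg (Finset.filter_subset _ _) (by intros; positivity)
      _ ≤ ∑ i, ∑ r ∈ S, ‖v i r.2‖ ^ 2 :=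
          Finset.single_le_sum (f := fun i => ∑ r ∈ S, ‖v i r.2‖ ^ 2)
            (fun _ _ => by positivity) (Finset.mem_univ i)
      _ ≤ M := by simp [M]
  have h2 : ∀ r : Request KR N F,
      ‖((M⁻¹ : ℝ) : ℂ) * v i r.2‖ ^ 2 = (M⁻¹) ^ 2 * ‖v i r.2‖ ^ 2 := by
    intro r
    rw [norm_mul, mul_pow, Complex.norm_real, Real.norm_eq_abs, sq_abs]
  simp only [h2]
  rw [← Finset.mul_sum]
  calc _ ≤ (M⁻¹) ^ 2 * M := by
        refine mul_le_mul_of_nonneg_left ?_ (by positivity)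
        convert h1
    _ = M⁻¹ := by field_simp
    _ ≤ 1 := inv_le_one_of_one_le₀ hM

theorem gain_smul (P : Fin KT → Finset (Packet N F)) (h : Channel KT KR) (v : Beamformer KT N F)
    (c : ℂ) (j : Fin KR) (w : Packet N F) :
    gain P h (fun i w => c * v i w) j w = c * gain P h v j w := by
  simp only [gain_eq, Finset.mul_sum]
  exact Finset.sum_congr rfl fun i _ => by ring

theorem decodable_of_gain {P : Fin KT → Finset (Packet N F)} {U : Fin KR → Finset (Packet N F)}
    {S : Finset (Request KR N F)} {h : Channel KT KR} {v : Beamformer KT N F}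
    (hU : ∀ r ∈ S, r.2 ∉ U r.1) (hsnd : Set.InjOn Prod.snd (S : Set (Request KR N F)))
    (hne : ∀ r ∈ S, gain P h v r.1 r.2 ≠ 0)
    (hz : ∀ r ∈ S, ∀ s ∈ S, s ≠ r → s.2 ∉ U r.1 → gain P h v r.1 s.2 = 0) :
    Decodable P U S h v := by
  intro r hr
  refine ⟨(gain P h v r.1 r.2)⁻¹, fun w => -((gain P h v r.1 r.2)⁻¹ * gain P h v r.1 w), ?_⟩
  intro s hs
  by_cases hsr : s = r
  · subst hsr
    simp [hU s hs, hne s hs]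
  · have hsr2 : s.2 ≠ r.2 := fun h2 => hsr (hsnd hs hr h2)
    by_cases hsU : s.2 ∈ U r.1
    · simp [hsU, hsr2]
    · simp [hsU, hsr2, hz r hr s hs hsr hsU]

theorem Decodable.gain_ne_zero {P : Fin KT → Finset (Packet N F)}
    {U : Fin KR → Finset (Packet N F)} {S : Finset (Request KR N F)} {h : Channel KT KR}
    {v : Beamformer KT N F} (hd : Decodable P U S h v) (hU : ∀ r ∈ S, r.2 ∉ U r.1)
    {r : Request KR N F} (hr : r ∈ S) : gain P h v r.1 r.2 ≠ 0 := by
  obtain ⟨a, b, hab⟩ := hd r hr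
  intro h0
  have := hab r hr
  simp [hU r hr, h0] at this

theorem Decodable.gain_eq_zero {P : Fin KT → Finset (Packet N F)}
    {U : Fin KR → Finset (Packet N F)} {S : Finset (Request KR N F)} {h : Channel KT KR}
    {v : Beamformer KT N F} (hd : Decodable P U S h v) (hU : ∀ r ∈ S, r.2 ∉ U r.1)
    (hsnd : Set.InjOn Prod.snd (S : Set (Request KR N F)))
    {r s : Request KR N F} (hr : r ∈ S) (hs : s ∈ S) (hsr : s ≠ r) (hsU : s.2 ∉ U r.1) :
    gain P h v r.1 s.2 = 0 := by
  obtain ⟨a, b, hab⟩ := hd r hr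
  have h1 := hab r hr
  have h2 := hab s hs
  have hsr2 : s.2 ≠ r.2 := fun h2 => hsr (hsnd hs hr h2)
  simp only [hU r hr, if_false, add_zero, if_true] at h1
  simp only [hsU, if_false, add_zero, hsr2] at h2
  rcases mul_eq_zero.mp h2 with h0 | h0
  · simp [h0] at h1
  · exact h0

theorem decodable_smul {P : Fin KT → Finset (Packet N F)} {U : Fin KR → Finset (Packet N F)}
    {S : Finset (Request KR N F)} {h : Channel KT KR} {v : Beamformer KT N F} {c : ℂ}
    (hc : c ≠ 0) (hd : Decodable P U S h v) : Decodable P U S h (fun i w => c * v i w) := by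
  intro r hr
  obtain ⟨a, b, hab⟩ := hd r hr
  refine ⟨a * c⁻¹, b, fun s hs => ?_⟩
  rw [gain_smul, ← hab s hs]
  field_simp

/-- Feasibility with perfect CSIT: every packet has more transmitters than receivers of the block
at which it is neither wanted nor known. -/
theorem feasibleP_of_card {νp : Measure (Channel KT KR)} (hν : νp ≪ volume)
    {P : Fin KT → Finset (Packet N F)} {U : Fin KR → Finset (Packet N F)}
    {S : Finset (Request KR N F)} (hU : ∀ r ∈ S, r.2 ∉ U r.1)
    (hfst : Set.InjOn Prod.fst (S : Set (Request KR N F)))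
    (hsnd : Set.InjOn Prod.snd (S : Set (Request KR N F)))
    (hcard : ∀ r ∈ S, S.card ≤ (transmitters P r.2).card +
      ((cachers U r.2) ∩ S.image Prod.fst).card) : FeasibleP νp P U S := by
  classical
  filter_upwards [hν.ae_le ae_isGeneric] with h hh
  have hex : ∀ r ∈ S, ∃ v : Fin KT → ℂ, ∑ i ∈ transmitters P r.2, h r.1 i * v i ≠ 0 ∧
      ∀ s ∈ S, s ≠ r → r.2 ∉ U s.1 → ∑ i ∈ transmitters P r.2, h s.1 i * v i = 0 := by
    intro r hr
    have hr1 : r.1 ∈ S.image Prod.fst \ cachers U r.2 := by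
      simp only [Finset.mem_sdiff, mem_cachers]
      exact ⟨Finset.mem_image_of_mem _ hr, hU r hr⟩
    have hc : ((S.image Prod.fst \ cachers U r.2).erase r.1).card < (transmitters P r.2).card := by
      have h1 := Finset.card_erase_add_one hr1
      have h2 := Finset.card_sdiff_add_card_inter (S.image Prod.fst) (cachers U r.2)
      have h3 := Finset.card_image_of_injOn hfst
      have h4 := hcard r hr
      rw [Finset.inter_comm] at h4
      omega
    obtain ⟨v, hv1, hv2⟩ := hh.exists_zeroForcing (Finset.notMem_erase _ _) hc
    refine ⟨v, hv1, fun s hs hsr hsU => hv2 _ ?_⟩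
    simp only [Finset.mem_erase, Finset.mem_sdiff, mem_cachers]
    exact ⟨fun he => hsr (hfst hs hr he), Finset.mem_image_of_mem _ hs, hsU⟩
  choose! V hV1 hV2 using hex
  -- Zero-forcing vectors are indexed by requests, beamformers by packets; the two agree because the
  -- packets of a block are distinct.
  let v : Beamformer KT N F := fun i w =>
    if hw : ∃ r ∈ S, r.2 = w then V hw.choose i else 0
  have hv : ∀ r ∈ S, ∀ i, v i r.2 = V r i := by
    intro r hr i
    have hw : ∃ r' ∈ S, r'.2 = r.2 := ⟨r, hr, rfl⟩
    have : hw.choose = r := hsnd hw.choose_spec.1 hr hw.choose_spec.2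
    simp only [v, dif_pos hw, this]
  have hdec : Decodable P U S h v := by
    apply decodable_of_gain hU hsnd
    · intro r hr
      rw [gain_eq]
      simpa only [hv r hr] using hV1 r hr
    · intro r hr s hs hsr hsU
      rw [gain_eq]
      simpa only [hv s hs] using hV2 s hs r hr hsr.symm hsU
  obtain ⟨c, hc, hpow⟩ := exists_powerConstraint_smul P S v
  exact ⟨_, hpow, decodable_smul hc hdec⟩

/-- Feasibility without CSIT: every packet of the block is known to all the other receivers. -/
theorem feasibleN_of_clique {νn : Measure (Channel KT KR)} (hν : νn ≪ volume)
    {P : Fin KT → Finset (Packet N F)} {U : Fin KR → Finset (Packet N F)}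
    {S : Finset (Request KR N F)} (hU : ∀ r ∈ S, r.2 ∉ U r.1)
    (hsnd : Set.InjOn Prod.snd (S : Set (Request KR N F)))
    (hT : ∀ r ∈ S, (transmitters P r.2).Nonempty)
    (hclique : ∀ r ∈ S, ∀ s ∈ S, s ≠ r → s.2 ∈ U r.1) : FeasibleN νn P U S := by
  classical
  -- One transmitter per packet suffices, since nothing has to be nulled over the air.
  let v : Beamformer KT N F := fun i w =>
    if hw : (transmitters P w).Nonempty then if i = hw.choose then 1 else 0 else 0
  obtain ⟨c, hc, hpow⟩ := exists_powerConstraint_smul P S v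
  refine ⟨_, hpow, ?_⟩
  filter_upwards [hν.ae_le ae_isGeneric] with h hh
  apply decodable_smul hc
  apply decodable_of_gain hU hsnd
  · intro r hr
    rw [gain_eq, Finset.sum_eq_single (hT r hr).choose]
    · simp [v, hT r hr, hh.ne_zero]
    · intro i _ hi
      simp [v, hT r hr, hi]
    · intro hi
      exact absurd (hT r hr).choose_spec hi
  · intro r hr s hs hsr hsU
    exact absurd (hclique r hr s hs hsr) hsU

/-- The packet of r must vanish at every other scheduled receiver that does not cache it. If these
are at least as many as its transmitters, genericity forces the whole beamformer of the packet to
vanish, and it is lost at its destination. -/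
theorem card_le_of_feasibleP {νp : Measure (Channel KT KR)} [IsProbabilityMeasure νp]
    (hν : νp ≪ volume) {P : Fin KT → Finset (Packet N F)} {U : Fin KR → Finset (Packet N F)}
    {S : Finset (Request KR N F)} (hU : ∀ r ∈ S, r.2 ∉ U r.1)
    (hfst : Set.InjOn Prod.fst (S : Set (Request KR N F)))
    (hsnd : Set.InjOn Prod.snd (S : Set (Request KR N F)))
    (hf : FeasibleP νp P U S) {r : Request KR N F} (hr : r ∈ S) :
    S.card ≤ (transmitters P r.2).card + (cachers U r.2).card := by
  classical
  obtain ⟨h, hh, v, -, hd⟩ := (Eventually.and (hν.ae_le ae_isGeneric) hf).exists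
  by_contra! hlt
  have h3 := Finset.card_image_of_injOn hfst
  have hcard : (transmitters P r.2).card ≤ ((S.image Prod.fst \ cachers U r.2).erase r.1).card := by
    have h1 := Finset.pred_card_le_card_erase (s := S.image Prod.fst \ cachers U r.2) (a := r.1)
    have h2 := Finset.le_card_sdiff (cachers U r.2) (S.image Prod.fst)
    omega
  have h0 := hh.eq_zero_of_null hcard (v := fun i => v i r.2) (by
    intro z hz
    simp only [Finset.mem_erase, Finset.mem_sdiff, Finset.mem_image, mem_cachers] at hz
    obtain ⟨hzr, ⟨s, hs, rfl⟩, hsU⟩ := hz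
    rw [← gain_eq]
    exact hd.gain_eq_zero hU hsnd hs hr (fun he => hzr (by rw [he])) hsU)
  apply hd.gain_ne_zero hU hr
  rw [gain_eq]
  exact Finset.sum_eq_zero fun i hi => by rw [h0 i hi, mul_zero]

/-- The sum is affine in the single coefficient `h j i`, with slope `x i ≠ 0`, so only one value of
that coefficient is excluded. -/
theorem ae_sum_ne_zero {T : Finset (Fin KT)} {x : Fin KT → ℂ} {i : Fin KT} (hi : i ∈ T)
    (hx : x i ≠ 0) (j : Fin KR) : ∀ᵐ h : Channel KT KR, ∑ i ∈ T, h j i * x i ≠ 0 := by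
  classical
  let x₀ : Channel KT KR := fun j' i' => if j' = j ∧ i' = i then 1 else 0
  let s : Set (Channel KT KR) := {h | ∑ i ∈ T, h j i * x i ≠ 0}
  have hs : IsOpen s := by
    apply isOpen_ne_fun _ continuous_const
    fun_prop
  refine ae_mem_of_ae_add_linearMap_mem (LinearMap.toSpanSingleton ℂ (Channel KT KR) x₀)
    volume volume hs.measurableSet fun y => ?_
  have h0 : ∀ᵐ t : ℂ, t ≠ -(∑ i ∈ T, y j i * x i) / x i := by
    simp [ae_iff]
  filter_upwards [h0] with t ht h2
  apply ht
  simp only [x₀, LinearMap.toSpanSingleton_apply, Pi.add_apply, Pi.smul_apply, true_and,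
    smul_eq_mul, mul_ite, mul_one, mul_zero, add_mul, ite_mul, zero_mul, Finset.sum_add_distrib,
    Finset.sum_ite_eq', hi, if_true] at h2
  field_simp
  linear_combination h2

/-- The beamformer is fixed before the channel is drawn, so almost surely the packet reaches every
receiver. The other scheduled receivers can only remove it from their caches. -/
theorem card_le_of_feasibleN {νn : Measure (Channel KT KR)} [IsProbabilityMeasure νn]
    (hν : νn ≪ volume) {P : Fin KT → Finset (Packet N F)} {U : Fin KR → Finset (Packet N F)}
    {S : Finset (Request KR N F)} (hU : ∀ r ∈ S, r.2 ∉ U r.1)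
    (hfst : Set.InjOn Prod.fst (S : Set (Request KR N F)))
    (hsnd : Set.InjOn Prod.snd (S : Set (Request KR N F)))
    (hf : FeasibleN νn P U S) {r : Request KR N F} (hr : r ∈ S) :
    S.card ≤ 1 + (cachers U r.2).card := by
  classical
  obtain ⟨v, -, hv⟩ := hf
  have hex : ∃ i ∈ transmitters P r.2, v i r.2 ≠ 0 := by
    obtain ⟨h, hd⟩ := hv.exists
    by_contra! h0
    apply hd.gain_ne_zero hU hr
    rw [gain_eq]
    exact Finset.sum_eq_zero fun i hi => by rw [h0 i hi, mul_zero]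
  obtain ⟨i, hi, hvi⟩ := hex
  have hae : ∀ᵐ h ∂νn, ∀ j : Fin KR, ∑ i ∈ transmitters P r.2, h j i * v i r.2 ≠ 0 := by
    rw [ae_all_iff]
    exact fun j => hν.ae_le (ae_sum_ne_zero (x := fun i => v i r.2) hi hvi j)
  obtain ⟨h, hd, hg⟩ := (hv.and hae).exists
  have hsub : (S.erase r).image Prod.fst ⊆ cachers U r.2 := by
    intro j hj
    obtain ⟨s, hs, rfl⟩ := Finset.mem_image.mp hj
    rw [Finset.mem_erase] at hs
    rw [mem_cachers]
    by_contra hsU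
    apply hg s.1
    rw [← gain_eq]
    exact hd.gain_eq_zero hU hsnd hs.2 hr hs.1.symm hsU
  have h1 := Finset.card_le_card hsub
  rw [Finset.card_image_of_injOn (hfst.mono (by simp))] at h1
  have := Finset.card_erase_add_one hr
  omega

end Blocks

/-! ### Binomial sums and the factor 3 -/

section Constants

theorem binomial_sum_eq_one (k : ℕ) (x : ℝ) :
    ∑ l ∈ Finset.range (k + 1), (k.choose l : ℝ) * x ^ l * (1 - x) ^ (k - l) = 1 := by
  have := add_pow x (1 - x) k
  rw [add_sub_cancel, one_pow] at this
  refine Eq.trans (Finset.sum_congr rfl fun l _ => ?_) this.symm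
  ring

theorem binomial_sum_succ (k : ℕ) (x : ℝ) :
    ∑ l ∈ Finset.range (k + 1), ((k + 1).choose (l + 1) : ℝ) * x ^ (l + 1) * (1 - x) ^ (k - l) =
      1 - (1 - x) ^ (k + 1) := by
  have := binomial_sum_eq_one (k + 1) x
  rw [Finset.sum_range_succ'] at this
  simp only [Nat.choose_zero_right, Nat.cast_one, pow_zero, mul_one, one_mul, Nat.sub_zero,
    Nat.add_sub_add_right] at this
  linarith

/-- The mean of `1 / min {M + L, k + 1}` for a binomial variable `L`. -/
noncomputable def meanInvSize (k : ℕ) (M x : ℝ) : ℝ :=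
  ∑ l ∈ Finset.range (k + 1), (k.choose l : ℝ) * x ^ l * (1 - x) ^ (k - l) /
    min (M + l) ((k : ℝ) + 1)

theorem meanInvSize_pos {k : ℕ} {M x : ℝ} (hM : 1 ≤ M) (hx0 : 0 ≤ x) (hx1 : x < 1) :
    0 < meanInvSize k M x := by
  have hx : 0 < 1 - x := by linarith
  apply Finset.sum_pos'
  · intro l _
    have : 0 < min (M + l) ((k : ℝ) + 1) := by positivity
    positivity
  · refine ⟨0, by simp, ?_⟩
    have : 0 < min (M + (0 : ℕ)) ((k : ℝ) + 1) := by positivity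
    simp only [Nat.choose_zero_right, Nat.cast_one, pow_zero, mul_one, one_mul]
    positivity

theorem meanInvSize_mul_min_le {k : ℕ} {M x : ℝ} (hM : 1 ≤ M) (hx0 : 0 ≤ x) (hx1 : x < 1) :
    meanInvSize k M x * min M ((k : ℝ) + 1) ≤ 1 := by
  have hx : 0 < 1 - x := by linarith
  have hm : 0 < min M ((k : ℝ) + 1) := by positivity
  rw [← le_div_iff₀ hm]
  refine le_trans ?_ (le_of_eq (congrArg (· / min M ((k : ℝ) + 1)) (binomial_sum_eq_one k x)))
  simp only [Finset.sum_div]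
  refine Finset.sum_le_sum fun l _ => ?_
  have : min M ((k : ℝ) + 1) ≤ min (M + l) ((k : ℝ) + 1) :=
    min_le_min_right _ (by linarith [(Nat.cast_nonneg l : (0 : ℝ) ≤ l)])
  gcongr

/-- As M ≥ 1 and l ≤ k, the denominator is at least l + 1, and (k+1) C(k,l) = (l+1) C(k+1,l+1) then
bounds the sum by the probability that a binomial variable with parameters k + 1 and x is nonzero.
-/
theorem meanInvSize_mul_le {k : ℕ} {M x : ℝ} (hM : 1 ≤ M) (hx0 : 0 ≤ x) (hx1 : x < 1) :
    meanInvSize k M x * (((k : ℝ) + 1) * x) ≤ 1 := by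
  have hx : 0 < 1 - x := by linarith
  have h1 : (1 : ℝ) - (1 - x) ^ (k + 1) ≤ 1 := by linarith [pow_pos hx (k + 1)]
  refine le_trans ?_ h1
  rw [← binomial_sum_succ, meanInvSize, Finset.sum_mul]
  refine Finset.sum_le_sum fun l hl => ?_
  have hl' : (l : ℝ) ≤ k := by exact_mod_cast Nat.lt_succ_iff.mp (Finset.mem_range.mp hl)
  have hle : (l : ℝ) + 1 ≤ min (M + l) ((k : ℝ) + 1) := le_min (by linarith) (by linarith)
  have hpos : (0 : ℝ) < (l : ℝ) + 1 := by positivity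
  have hc : ((k + 1).choose (l + 1) : ℝ) * ((l : ℝ) + 1) = ((k : ℝ) + 1) * k.choose l := by
    exact_mod_cast (Nat.add_one_mul_choose_eq k l).symm
  calc _ ≤ (k.choose l : ℝ) * x ^ l * (1 - x) ^ (k - l) / ((l : ℝ) + 1) * (((k : ℝ) + 1) * x) := by
        gcongr
    _ = ((k + 1).choose (l + 1) : ℝ) * x ^ (l + 1) * (1 - x) ^ (k - l) := by
        field_simp
        linear_combination (-(x ^ (l + 1))) * hc

/-- Upper bound on the average block size with perfect CSIT. -/
noncomputable def blockBoundP (K : ℕ) (M x : ℝ) : ℝ := min (K : ℝ) (M / (1 - x) + K * x)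

theorem blockBoundP_pos {k : ℕ} {M x : ℝ} (hM : 1 ≤ M) (hx0 : 0 ≤ x) (hx1 : x < 1) :
    0 < blockBoundP (k + 1) M x := by
  have hx : 0 < 1 - x := by linarith
  unfold blockBoundP
  positivity

theorem blockBoundP_le {k : ℕ} {M x : ℝ} (hM : 1 ≤ M) (hx0 : 0 ≤ x) (hx1 : x < 1) :
    blockBoundP (k + 1) M x ≤ 3 * (1 / meanInvSize k M x) := by
  have hx : 0 < 1 - x := by linarith
  have hE := meanInvSize_pos (k := k) hM hx0 hx1
  have h1 := meanInvSize_mul_min_le (k := k) hM hx0 hx1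
  have h2 := meanInvSize_mul_le (k := k) hM hx0 hx1
  have hK : blockBoundP (k + 1) M x ≤ (k : ℝ) + 1 :=
    (min_le_left _ _).trans (by push_cast; exact le_rfl)
  rw [mul_one_div, le_div_iff₀ hE]
  set E := meanInvSize k M x
  have hKE : blockBoundP (k + 1) M x * E ≤ ((k : ℝ) + 1) * E :=
    mul_le_mul_of_nonneg_right hK hE.le
  have hk : (0 : ℝ) ≤ ((k : ℝ) + 1) * E := by positivity
  -- For x ≥ 1/3, the bound k + 1 is at most 3(k+1)x, and (k+1)xE ≤ 1. For x < 1/3 either k + 1 ≤ M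
  -- and (k+1)E ≤ 1, or M/(1-x) ≤ 2M, and ME ≤ 1 and (k+1)xE ≤ 1 add up to 2 + 1.
  rcases le_or_gt (1 / 3) x with h3 | h3
  · nlinarith
  · rcases le_total ((k : ℝ) + 1) M with hkM | hkM
    · rw [min_eq_right hkM] at h1
      linarith
    · rw [min_eq_left hkM] at h1
      have hc : blockBoundP (k + 1) M x ≤ 2 * M + ((k : ℝ) + 1) * x := by
        refine (min_le_right _ _).trans ?_
        have : M / (1 - x) ≤ 2 * M := by
          rw [div_le_iff₀ hx]; nlinarith
        push_cast
        linarith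
      have := mul_le_mul_of_nonneg_right hc hE.le
      linarith

/-- For x > 0, p = 1 - (1-x)^(k+1) is at most 1 and, by Bernoulli, at most (k+1)x. So (1 + (k+1)x)p
≤ 2(k+1)x, and even the factor 2 would do. -/
theorem one_add_le_three_mul {k : ℕ} {x : ℝ} (hx0 : 0 ≤ x) (hx1 : x < 1) :
    1 + ((k : ℝ) + 1) * x ≤ 3 * (if x = 0 then 1 else
      ((k : ℝ) + 1) * x / (1 - (1 - x) ^ (k + 1))) := by
  split_ifs with h0
  · rw [h0]; norm_num
  · have hx : 0 < x := lt_of_le_of_ne hx0 (Ne.symm h0)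
    have hp : (1 - x) ^ (k + 1) < 1 := pow_lt_one₀ (by linarith) (by linarith) (by omega)
    have hp0 : 0 < (1 - x) ^ (k + 1) := pow_pos (by linarith) _
    have hb := one_add_mul_le_pow (a := -x) (by linarith) (k + 1)
    rw [← sub_eq_add_neg] at hb
    push_cast at hb
    rw [mul_div_assoc', le_div_iff₀ (by linarith)]
    have : 0 ≤ ((k : ℝ) + 1) * x := by positivity
    nlinarith

theorem decentralizedDoF_eq (KT k : ℕ) (μT μR α : ℝ) :
    decentralizedDoF KT (k + 1) μT μR α = α * (1 / meanInvSize k (KT * μT) μR) +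
      (1 - α) * (if μR = 0 then 1 else ((k : ℝ) + 1) * μR / (1 - (1 - μR) ^ (k + 1))) := by
  unfold decentralizedDoF meanInvSize
  push_cast
  congr 3
  refine Finset.sum_congr rfl fun l _ => ?_
  have : k + 1 - l - 1 = k - l := by omega
  rw [this]

end Constants

/-! ### Upper bound on the DoF of any placement -/

section Converse

variable {KT KR N F : ℕ}

/-- Each request pays at most the reciprocal of the size of a block that serves it, and the requests
of one block together pay at most 1. -/
theorem IsSchedule.sum_le {feas : Finset (Request KR N F) → Prop} {D : Finset (Request KR N F)}
    {H : ℕ} {B : Fin H → Finset (Request KR N F)} (h : IsSchedule feas D H B)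
    {g : Request KR N F → ℝ} (hg : ∀ m, ∀ r ∈ B m, g r ≤ 1 / (B m).card) :
    ∑ r ∈ D, g r ≤ H := by
  classical
  calc ∑ r ∈ D, g r ≤ ∑ r ∈ D, ∑ m, if r ∈ B m then (1 : ℝ) / (B m).card else 0 := by
        refine Finset.sum_le_sum fun r hr => ?_
        obtain ⟨m, hm⟩ := h.2 r hr
        refine (hg m r hm).trans ?_
        have := Finset.single_le_sum
          (f := fun m => if r ∈ B m then (1 : ℝ) / (B m).card else 0)
          (fun m _ => by split_ifs <;> positivity) (Finset.mem_univ m)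
        simpa [hm] using this
    _ = ∑ m, ∑ r ∈ D, if r ∈ B m then (1 : ℝ) / (B m).card else 0 := Finset.sum_comm
    _ ≤ ∑ _m : Fin H, (1 : ℝ) := by
        refine Finset.sum_le_sum fun m _ => ?_
        rw [Finset.sum_ite_mem, Finset.inter_eq_right.mpr (h.1 m).1, Finset.sum_const,
          nsmul_eq_mul, mul_one_div]
        exact div_self_le_one _
    _ = H := by simp

/-- The left side is the tangent to 1/s at s = c, which lies below the convex function 1/s ≤ 1/n.
Being affine in s, it can be averaged over packets and demands at once. -/
theorem tangent_le_inv {c s n : ℝ} (hc : 0 < c) (hn : 0 < n) (hns : n ≤ s) :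
    2 / c - s / c ^ 2 ≤ 1 / n := by
  rw [le_div_iff₀ hn]
  have : (2 / c - s / c ^ 2) * n = (2 * c * n - s * n) / c ^ 2 := by field_simp
  rw [this, div_le_one (by positivity)]
  nlinarith [sq_nonneg (c - n)]

theorem sum_sum_requests_const (U : Fin KR → Finset (Packet N F)) (g : Packet N F → ℝ) :
    ∑ n : Fin N, ∑ r ∈ requests (fun _ => n) U, g r.2 =
      ∑ w, ((KR : ℝ) - (cachers U w).card) * g w := by
  classical
  have h1 : ∀ n : Fin N, ∑ r ∈ requests (fun _ => n) U, g r.2 =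
      ∑ r : Request KR N F, if r.2.1 = n then (if r.2 ∉ U r.1 then g r.2 else 0) else 0 := by
    intro n
    rw [requests, Finset.sum_filter]
    refine Finset.sum_congr rfl fun r _ => ?_
    rw [← ite_and]
  simp only [h1]
  rw [Finset.sum_comm]
  simp only [Finset.sum_ite_eq, Finset.mem_univ, if_true]
  rw [Fintype.sum_prod_type, Finset.sum_comm]
  refine Finset.sum_congr rfl fun w _ => ?_
  rw [← Finset.sum_filter]
  change ∑ _j ∈ Finset.univ.filter (fun j => w ∉ U j), g w = _
  rw [Finset.sum_const, nsmul_eq_mul]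
  congr 1
  have h2 : (Finset.univ.filter fun j => w ∉ U j) = (cachers U w)ᶜ := by
    ext j; simp [mem_cachers]
  rw [h2, Finset.card_compl, Fintype.card_fin, Nat.cast_sub]
  simpa using Finset.card_le_univ (cachers U w)

/-- If the weighted mean of `s` is at most `c`, some constant demand needs at least one block per
`c` requests. -/
theorem exists_demand {U : Fin KR → Finset (Packet N F)} (hU : ∃ j w, w ∉ U j)
    {s : Packet N F → ℝ} {c : ℝ} (hc : 0 < c)
    (hs : ∑ w, ((KR : ℝ) - (cachers U w).card) * s w ≤
      c * ∑ w, ((KR : ℝ) - (cachers U w).card)) :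
    ∃ n, (requests (fun _ => n) U).Nonempty ∧
      ((requests (fun _ => n) U).card : ℝ) / c ≤
        ∑ r ∈ requests (fun _ => n) U, (2 / c - s r.2 / c ^ 2) := by
  classical
  let D := fun n : Fin N => requests (fun _ => n) U
  obtain ⟨j, w, hw⟩ := hU
  -- Files with nothing to deliver add zero to both sums but are not admissible as a worst-case
  -- demand, so they are removed before an index is chosen.
  let A := Finset.univ.filter fun n => (D n).Nonempty
  have hA : A.Nonempty := ⟨w.1, by simpa [A] using ⟨(j, w), by simp [D, mem_requests, hw]⟩⟩
  have hsum : ∀ f : Request KR N F → ℝ, ∑ n ∈ A, ∑ r ∈ D n, f r = ∑ n, ∑ r ∈ D n, f r := by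
    intro f
    refine Finset.sum_subset (Finset.subset_univ _) fun n _ hn => ?_
    have : D n = ∅ := by simpa [A] using hn
    rw [this, Finset.sum_empty]
  have h1 := sum_sum_requests_const U (fun _ => 1 / c)
  have h2 := sum_sum_requests_const U (fun w => 2 / c - s w / c ^ 2)
  have hle : ∑ n ∈ A, ((D n).card : ℝ) / c ≤ ∑ n ∈ A, ∑ r ∈ D n, (2 / c - s r.2 / c ^ 2) := by
    have h3 : ∀ n, ((D n).card : ℝ) / c = ∑ r ∈ D n, 1 / c := by
      intro n; simp [div_eq_mul_inv]
    simp only [h3]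
    rw [hsum, hsum, h1, h2]
    simp only [mul_sub, Finset.sum_sub_distrib]
    rw [← Finset.sum_mul, ← Finset.sum_mul]
    have h4 : ∑ w, ((KR : ℝ) - (cachers U w).card) * (s w / c ^ 2) =
        (∑ w, ((KR : ℝ) - (cachers U w).card) * s w) / c ^ 2 := by
      rw [Finset.sum_div]; exact Finset.sum_congr rfl fun w _ => by ring
    rw [h4]
    have h5 : (∑ w, ((KR : ℝ) - (cachers U w).card) * s w) / c ^ 2 ≤
        (∑ w, ((KR : ℝ) - (cachers U w).card)) * (1 / c) := by
      rw [div_le_iff₀ (by positivity)]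
      refine hs.trans (le_of_eq ?_)
      field_simp
    have h6 : (∑ w, ((KR : ℝ) - (cachers U w).card)) * (2 / c) =
        (∑ w, ((KR : ℝ) - (cachers U w).card)) * (1 / c) +
        (∑ w, ((KR : ℝ) - (cachers U w).card)) * (1 / c) := by ring
    linarith
  obtain ⟨n, hn, hn2⟩ := Finset.exists_le_of_sum_le hA hle
  exact ⟨n, (Finset.mem_filter.mp hn).2, hn2⟩

theorem sum_card_cachers (U : Fin KR → Finset (Packet N F)) :
    ∑ w, (cachers U w).card = ∑ j, (U j).card := by
  classical
  simp only [cachers, Finset.card_filter]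
  rw [Finset.sum_comm]
  simp

theorem sum_card_transmitters (P : Fin KT → Finset (Packet N F)) :
    ∑ w, (transmitters P w).card = ∑ i, (P i).card := by
  classical
  simp only [transmitters, Finset.card_filter]
  rw [Finset.sum_comm]
  simp

theorem card_cachers_le (U : Fin KR → Finset (Packet N F)) (w : Packet N F) :
    ((cachers U w).card : ℝ) ≤ KR := by
  have := Finset.card_le_univ (cachers U w)
  rw [Fintype.card_fin] at this
  exact_mod_cast this

theorem sum_const_packet (x : ℝ) : ∑ _w : Packet N F, x = (N * F) * x := by simp

/-- With R the number of cachers, (K-R)R is concave in R and lies below its tangent at Kμ, by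
exactly (R-Kμ)². Summed over the packets, the remaining term in R - Kμ is nonpositive by the memory
constraint. -/
theorem sum_mul_cachers_le {U : Fin KR → Finset (Packet N F)} {μR : ℝ} (hμ : μR ≤ 1)
    (hUc : ∀ j, ((U j).card : ℝ) ≤ μR * N * F) :
    ∑ w, ((KR : ℝ) - (cachers U w).card) * (cachers U w).card ≤
      (KR * μR) * ∑ w, ((KR : ℝ) - (cachers U w).card) := by
  set R : Packet N F → ℝ := fun w => ((cachers U w).card : ℝ) with hR
  set K : ℝ := (KR : ℝ)
  have hS : ∑ w, R w ≤ K * μR * (N * F) := by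
    have h1 : ∑ w, R w = ∑ j, ((U j).card : ℝ) := by
      simp only [hR]
      exact_mod_cast sum_card_cachers U
    rw [h1]
    calc _ ≤ ∑ _j : Fin KR, μR * N * F := Finset.sum_le_sum fun j _ => hUc j
      _ = _ := by simp [K]; ring
  have key : ∀ w, (K - R w) * R w ≤
      K * μR * (K - R w) + (K * (1 - μR)) * (R w - K * μR) := by
    intro w
    nlinarith [sq_nonneg (R w - K * μR)]
  calc _ ≤ ∑ w, (K * μR * (K - R w) + (K * (1 - μR)) * (R w - K * μR)) :=
        Finset.sum_le_sum fun w _ => key w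
    _ = (K * μR) * ∑ w, (K - R w) + (K * (1 - μR)) * (∑ w, R w - K * μR * (N * F)) := by
        rw [Finset.sum_add_distrib, ← Finset.mul_sum, ← Finset.mul_sum, Finset.sum_sub_distrib R,
          sum_const_packet]
        ring
    _ ≤ _ := by
        have : (K * (1 - μR)) * (∑ w, R w - K * μR * (N * F)) ≤ 0 :=
          mul_nonpos_of_nonneg_of_nonpos (mul_nonneg (Nat.cast_nonneg _) (by linarith))
            (by linarith)
        linarith

theorem mean_sizeN_le {U : Fin KR → Finset (Packet N F)} {μR : ℝ} (hμ : μR ≤ 1)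
    (hUc : ∀ j, ((U j).card : ℝ) ≤ μR * N * F) :
    ∑ w, ((KR : ℝ) - (cachers U w).card) * (1 + (cachers U w).card) ≤
      (1 + KR * μR) * ∑ w, ((KR : ℝ) - (cachers U w).card) := by
  have := sum_mul_cachers_le hμ hUc
  simp only [mul_add, Finset.sum_add_distrib, mul_one, add_mul, one_mul]
  linarith

/-- In the transmitter term, the weight K_R - r is at most K_R, while the weights sum to at least
K_R(1-μ_R)NF. This is the origin of K_T μ_T/(1-μ_R). -/
theorem mean_sizeP_le {P : Fin KT → Finset (Packet N F)} {U : Fin KR → Finset (Packet N F)}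
    {μT μR : ℝ} (hμT : 0 ≤ KT * μT) (hμ : μR < 1)
    (hPc : ∀ i, ((P i).card : ℝ) ≤ μT * N * F)
    (hUc : ∀ j, ((U j).card : ℝ) ≤ μR * N * F) :
    ∑ w, ((KR : ℝ) - (cachers U w).card) *
        min (KR : ℝ) ((transmitters P w).card + (cachers U w).card) ≤
      blockBoundP KR (KT * μT) μR * ∑ w, ((KR : ℝ) - (cachers U w).card) := by
  have hu : ∀ w, 0 ≤ (KR : ℝ) - (cachers U w).card := fun w => by
    linarith [card_cachers_le U w]
  have hu0 : 0 ≤ ∑ w, ((KR : ℝ) - (cachers U w).card) := Finset.sum_nonneg fun w _ => hu w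
  rw [blockBoundP, min_mul_of_nonneg _ _ hu0]
  apply le_min
  · rw [Finset.mul_sum]
    refine Finset.sum_le_sum fun w _ => ?_
    rw [mul_comm]
    exact mul_le_mul_of_nonneg_right (min_le_left _ _) (hu w)
  · have hR := sum_mul_cachers_le hμ.le hUc
    have hT : ∑ w, ((transmitters P w).card : ℝ) ≤ KT * μT * (N * F) := by
      have h1 : ∑ w, ((transmitters P w).card : ℝ) = ∑ j, ((P j).card : ℝ) := by
        exact_mod_cast sum_card_transmitters P
      rw [h1]
      calc _ ≤ ∑ _j : Fin KT, μT * N * F := Finset.sum_le_sum fun j _ => hPc j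
        _ = _ := by simp; ring
    have hS : ∑ w, ((cachers U w).card : ℝ) ≤ KR * μR * (N * F) := by
      have h1 : ∑ w, ((cachers U w).card : ℝ) = ∑ j, ((U j).card : ℝ) := by
        exact_mod_cast sum_card_cachers U
      rw [h1]
      calc _ ≤ ∑ _j : Fin KR, μR * N * F := Finset.sum_le_sum fun j _ => hUc j
        _ = _ := by simp; ring
    have h2 : ∑ w, ((KR : ℝ) - (cachers U w).card) * (transmitters P w).card ≤
        KR * (KT * μT * (N * F)) := by
      refine le_trans ?_ (mul_le_mul_of_nonneg_left hT (Nat.cast_nonneg KR))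
      rw [Finset.mul_sum]
      refine Finset.sum_le_sum fun w _ => mul_le_mul_of_nonneg_right ?_ (Nat.cast_nonneg _)
      linarith [(Nat.cast_nonneg (cachers U w).card : (0 : ℝ) ≤ _)]
    have h3 : KR * (1 - μR) * (N * F) ≤ ∑ w, ((KR : ℝ) - (cachers U w).card) := by
      rw [Finset.sum_sub_distrib, sum_const_packet]
      linarith
    have h4 : KR * (KT * μT * (N * F)) ≤
        KT * μT / (1 - μR) * ∑ w, ((KR : ℝ) - (cachers U w).card) := by
      have h0 : 0 < 1 - μR := by linarith
      refine le_trans (le_of_eq ?_) (mul_le_mul_of_nonneg_left h3 (by positivity))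
      field_simp
    rw [add_mul]
    calc _ ≤ ∑ w, (((KR : ℝ) - (cachers U w).card) * (transmitters P w).card +
          ((KR : ℝ) - (cachers U w).card) * (cachers U w).card) := by
          refine Finset.sum_le_sum fun w _ => ?_
          rw [← mul_add]
          exact mul_le_mul_of_nonneg_left (min_le_right _ _) (hu w)
      _ ≤ _ := by
          rw [Finset.sum_add_distrib]
          linarith

theorem div_deliveryTime_le {α q κ c x : ℝ} {Hp Hn : ℕ} {n : ℕ} (hκ : 0 < κ) (hc : 0 < c)
    (hx : (n : ℝ) / c ≤ x)
    (h : ENNReal.ofReal (c / κ) ≤ ENNReal.ofReal q / ENNReal.ofReal α ∧ x ≤ Hp ∨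
      ENNReal.ofReal (c / κ) ≤ ENNReal.ofReal (1 - q) / ENNReal.ofReal (1 - α) ∧ x ≤ Hn) :
    (n : ℝ≥0∞) / deliveryTime α q Hp Hn ≤ ENNReal.ofReal κ := by
  apply ENNReal.div_le_of_le_mul
  have aux : ∀ (y : ℝ≥0∞) (H : ℕ), ENNReal.ofReal (c / κ) ≤ y → x ≤ H →
      (n : ℝ≥0∞) ≤ ENNReal.ofReal κ * (y * H) := by
    intro y H hy hH
    calc (n : ℝ≥0∞) ≤ ENNReal.ofReal (κ * (c / κ * H)) := by
          rw [← ENNReal.ofReal_natCast]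
          apply ENNReal.ofReal_le_ofReal
          have : κ * (c / κ * H) = c * H := by field_simp
          rw [this, mul_comm]
          exact (div_le_iff₀ hc).mp (hx.trans hH)
      _ = ENNReal.ofReal κ * (ENNReal.ofReal (c / κ) * H) := by
          rw [ENNReal.ofReal_mul hκ.le, ENNReal.ofReal_mul (by positivity), ENNReal.ofReal_natCast]
      _ ≤ _ := by gcongr
  rcases h with ⟨h1, h2⟩ | ⟨h1, h2⟩
  · exact (aux _ _ h1 h2).trans (by unfold deliveryTime; gcongr; exact le_max_left _ _)
  · exact (aux _ _ h1 h2).trans (by unfold deliveryTime; gcongr; exact le_max_right _ _)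

/-- The shares αc/κ and (1-α)b/κ add up to 1, so q and 1 - q cannot both fall below theirs. For α
equal to 0 or 1, the subchannel without bandwidth either gets no data or takes infinite time. -/
theorem ofReal_le_div_or {α q c b κ : ℝ} (hα0 : 0 ≤ α) (hα1 : α ≤ 1) (hq0 : 0 ≤ q) (hq1 : q ≤ 1)
    (hc : 0 < c) (hb : 0 < b) (hκ : κ = α * c + (1 - α) * b) (hκ0 : 0 < κ) :
    ENNReal.ofReal (c / κ) ≤ ENNReal.ofReal q / ENNReal.ofReal α ∨
      ENNReal.ofReal (b / κ) ≤ ENNReal.ofReal (1 - q) / ENNReal.ofReal (1 - α) := by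
  have pos : ∀ {x y z : ℝ}, 0 < y → z * y ≤ x →
      ENNReal.ofReal z ≤ ENNReal.ofReal x / ENNReal.ofReal y := by
    intro x y z hy h
    rw [← ENNReal.ofReal_div_of_pos hy]
    exact ENNReal.ofReal_le_ofReal ((le_div_iff₀ hy).mpr h)
  have top : ∀ {x z : ℝ}, 0 < x → ENNReal.ofReal z ≤ ENNReal.ofReal x / ENNReal.ofReal 0 := by
    intro x z hx
    rw [ENNReal.ofReal_zero, ENNReal.div_zero (by simpa using hx)]
    exact le_top
  rcases hα0.eq_or_lt with h0 | h0
  · subst h0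
    rcases hq0.eq_or_lt with hq | hq
    · subst hq
      right
      apply pos (by norm_num)
      have : κ = b := by rw [hκ]; ring
      rw [this, div_self hb.ne']; norm_num
    · exact Or.inl (top hq)
  · rcases hα1.eq_or_lt with h1 | h1
    · subst h1
      rcases hq1.eq_or_lt with hq | hq
      · subst hq
        left
        apply pos (by norm_num)
        have : κ = c := by rw [hκ]; ring
        rw [this, div_self hc.ne']; norm_num
      · right
        rw [sub_self]
        exact top (by linarith)
    · rcases le_total (c / κ * α) q with h | h
      · exact Or.inl (pos h0 h)
      · right
        apply pos (by linarith)
        have : c / κ * α + b / κ * (1 - α) = 1 := by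
          field_simp
          rw [hκ]; ring
        linarith

theorem realizationDoF_le {νp νn : Measure (Channel KT KR)} [IsProbabilityMeasure νp]
    [IsProbabilityMeasure νn] (hνp : νp ≪ volume) (hνn : νn ≪ volume) (hKR : 1 ≤ KR)
    {μT μR α q : ℝ} (hlib : 1 ≤ (KT : ℝ) * μT) (hμR0 : 0 ≤ μR) (hμR1 : μR < 1) (hα0 : 0 ≤ α)
    (hα1 : α ≤ 1) (hq0 : 0 ≤ q) (hq1 : q ≤ 1) (hN : 1 ≤ N) (hF : 1 ≤ F)
    {P : Fin KT → Finset (Packet N F)} {U : Fin KR → Finset (Packet N F)}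
    (hPc : ∀ i, ((P i).card : ℝ) ≤ μT * N * F) (hUc : ∀ j, ((U j).card : ℝ) ≤ μR * N * F) :
    realizationDoF α νp νn P U q ≤
      ENNReal.ofReal (α * blockBoundP KR (KT * μT) μR + (1 - α) * (1 + KR * μR)) := by
  obtain ⟨k, rfl⟩ : ∃ k, KR = k + 1 := ⟨KR - 1, by omega⟩
  have hc := blockBoundP_pos (k := k) hlib hμR0 hμR1
  have hb : 0 < 1 + ((k + 1 : ℕ) : ℝ) * μR := by positivity
  set c := blockBoundP (k + 1) (KT * μT) μR
  set b := 1 + ((k + 1 : ℕ) : ℝ) * μR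
  set κ := α * c + (1 - α) * b with hκdef
  have hκ : 0 < κ := by
    rcases hα0.eq_or_lt with h | h
    · rw [hκdef, ← h]; linarith
    · have : 0 ≤ (1 - α) * b := mul_nonneg (by linarith) hb.le
      have : 0 < α * c := mul_pos h hc
      linarith
  have hU : ∃ j w, w ∉ U j := by
    refine ⟨0, ?_⟩
    by_contra! hall
    have h1 : U 0 = Finset.univ := Finset.eq_univ_iff_forall.mpr hall
    have h2 := hUc 0
    rw [h1, Finset.card_univ] at h2
    simp only [Fintype.card_prod, Fintype.card_fin, Nat.cast_mul] at h2
    have h3 : (0 : ℝ) < N * F := by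
      have : 0 < N * F := Nat.mul_pos hN hF
      exact_mod_cast this
    nlinarith
  have hDU : ∀ (d : Fin (k + 1) → Fin N) {S}, S ⊆ requests d U → ∀ r ∈ S, r.2 ∉ U r.1 :=
    fun d S hS r hr => (mem_requests.mp (hS hr)).2
  have hcardS : ∀ S : Finset (Request (k + 1) N F),
      Set.InjOn Prod.fst (S : Set (Request (k + 1) N F)) → S.card ≤ k + 1 := by
    classical
    intro S hS
    rw [← Finset.card_image_of_injOn hS]
    simpa using Finset.card_le_univ (S.image Prod.fst)
  -- The file requested by all receivers depends on which subchannel is the bottleneck.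
  rcases ofReal_le_div_or hα0 hα1 hq0 hq1 hc hb hκdef hκ with hcase | hcase
  · obtain ⟨n, hn, hle⟩ := exists_demand hU hc (mean_sizeP_le (by linarith) hμR1 hPc hUc)
    refine iInf₂_le_of_le (fun _ => n) hn ?_
    simp only [iSup_le_iff]
    intro Hp Hn Bp Bn hBp _
    refine div_deliveryTime_le hκ hc hle (Or.inl ⟨hcase, hBp.sum_le fun m r hr => ?_⟩)
    obtain ⟨hsub, hfst, hsnd, hf⟩ := hBp.1 m
    apply tangent_le_inv hc
    · exact_mod_cast Finset.card_pos.mpr ⟨r, hr⟩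
    · apply le_min
      · exact_mod_cast hcardS _ hfst
      · exact_mod_cast card_le_of_feasibleP hνp (hDU _ hsub) hfst hsnd hf hr
  · obtain ⟨n, hn, hle⟩ := exists_demand hU hb (mean_sizeN_le hμR1.le hUc)
    refine iInf₂_le_of_le (fun _ => n) hn ?_
    simp only [iSup_le_iff]
    intro Hp Hn Bp Bn _ hBn
    refine div_deliveryTime_le hκ hb hle (Or.inr ⟨hcase, hBn.sum_le fun m r hr => ?_⟩)
    obtain ⟨hsub, hfst, hsnd, hf⟩ := hBn.1 m
    apply tangent_le_inv hb
    · exact_mod_cast Finset.card_pos.mpr ⟨r, hr⟩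
    · exact_mod_cast card_le_of_feasibleN hνn (hDU _ hsub) hfst hsnd hf hr

theorem networkDoF_le {νp νn : Measure (Channel KT KR)} [IsProbabilityMeasure νp]
    [IsProbabilityMeasure νn] (hνp : νp ≪ volume) (hνn : νn ≪ volume) (hKR : 1 ≤ KR)
    {μT μR α : ℝ} (hlib : 1 ≤ (KT : ℝ) * μT) (hμR0 : 0 ≤ μR) (hμR1 : μR < 1) (hα0 : 0 ≤ α)
    (hα1 : α ≤ 1) (hN : 1 ≤ N) (hF : 1 ≤ F) :
    (1 / 3 : ℝ≥0∞) * networkDoF KT KR N F μT μR α νp νn ≤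
      ENNReal.ofReal (decentralizedDoF KT KR μT μR α) := by
  have h1 : networkDoF KT KR N F μT μR α νp νn ≤
      3 * ENNReal.ofReal (decentralizedDoF KT KR μT μR α) := by
    simp only [networkDoF, iSup_le_iff]
    rintro P U q hP hU ⟨hq0, hq1⟩
    refine (realizationDoF_le hνp hνn hKR hlib hμR0 hμR1 hα0 hα1 hq0 hq1 hN hF hP hU).trans ?_
    have h3 : (3 : ℝ≥0∞) = ENNReal.ofReal 3 := by simp
    rw [h3, ← ENNReal.ofReal_mul (by norm_num)]
    apply ENNReal.ofReal_le_ofReal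
    obtain ⟨k, rfl⟩ : ∃ k, KR = k + 1 := ⟨KR - 1, by omega⟩
    rw [decentralizedDoF_eq]
    have h4 := mul_le_mul_of_nonneg_left (blockBoundP_le (k := k) hlib hμR0 hμR1) hα0
    have h5 := mul_le_mul_of_nonneg_left (one_add_le_three_mul (k := k) hμR0 hμR1)
      (sub_nonneg.mpr hα1)
    push_cast
    linarith
  calc _ ≤ (1 / 3 : ℝ≥0∞) * (3 * ENNReal.ofReal (decentralizedDoF KT KR μT μR α)) := by gcongr
    _ = _ := by
      rw [← mul_assoc, one_div, ENNReal.inv_mul_cancel (by norm_num) (by norm_num), one_mul]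

end Converse

/-! ### Concentration of cache patterns under random placement -/

section Concentration

theorem card_filter_notMem_powersetCard {F k : ℕ} (f : Fin F) :
    ((Finset.powersetCard k (Finset.univ : Finset (Fin F))).filter fun S => f ∉ S).card =
      (F - 1).choose k := by
  classical
  have : ((Finset.powersetCard k (Finset.univ : Finset (Fin F))).filter fun S => f ∉ S) =
      Finset.powersetCard k (Finset.univ.erase f) := by
    ext S
    simp only [Finset.mem_filter, Finset.mem_powersetCard, Finset.subset_univ, true_and,
      Finset.subset_erase]
    tauto
  rw [this, Finset.card_powersetCard, Finset.card_erase_of_mem (Finset.mem_univ _)]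
  simp

theorem card_filter_notMem_notMem_powersetCard {F k : ℕ} {f g : Fin F} (hfg : f ≠ g) :
    ((Finset.powersetCard k (Finset.univ : Finset (Fin F))).filter fun S => f ∉ S ∧ g ∉ S).card =
      (F - 2).choose k := by
  classical
  have : ((Finset.powersetCard k (Finset.univ : Finset (Fin F))).filter
      fun S => f ∉ S ∧ g ∉ S) = Finset.powersetCard k ((Finset.univ.erase f).erase g) := by
    ext S
    simp only [Finset.mem_filter, Finset.mem_powersetCard, Finset.subset_univ, true_and,
      Finset.subset_erase]
    tauto
  rw [this, Finset.card_powersetCard, Finset.card_erase_of_mem (by simp [hfg.symm]),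
    Finset.card_erase_of_mem (Finset.mem_univ _)]
  simp [Nat.sub_sub]

/-- The mean of `f` over the finite set `S`. -/
noncomputable def finsetMean {α : Type*} (S : Finset α) (f : α → ℝ) : ℝ := (∑ x ∈ S, f x) / S.card

open Classical in
/-- The indicator of a proposition. -/
noncomputable def indic (p : Prop) : ℝ := if p then 1 else 0

theorem indic_true {p : Prop} (h : p) : indic p = 1 := if_pos h

theorem indic_false {p : Prop} (h : ¬p) : indic p = 0 := if_neg h

theorem indic_nonneg (p : Prop) : 0 ≤ indic p := by
  unfold indic; split_ifs <;> norm_num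

theorem indic_mul_self (p : Prop) : indic p * indic p = indic p := by
  unfold indic; split_ifs <;> norm_num

theorem sum_indic {α : Type*} (S : Finset α) (p : α → Prop) [DecidablePred p] :
    ∑ x ∈ S, indic (p x) = ((S.filter p).card : ℝ) := by
  rw [Finset.card_filter, Nat.cast_sum]
  refine Finset.sum_congr rfl fun x _ => ?_
  by_cases h : p x <;> simp [indic, h]

/-- The probability that a uniformly random `k`-subset of `Fin F` contains a given element
(if `b`), or that it does not (if `¬b`). -/
noncomputable def subsetProb (F k : ℕ) (b : Prop) : ℝ :=
  indic b * (k / F) + (1 - indic b) * (1 - k / F)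

theorem mean_indic_mem {F k : ℕ} (hk : k ≤ F) (f : Fin F) (b : Prop) :
    finsetMean (Finset.powersetCard k (Finset.univ : Finset (Fin F)))
      (fun S => indic (f ∈ S ↔ b)) = subsetProb F k b := by
  classical
  obtain ⟨n, rfl⟩ : ∃ n, F = n + 1 := ⟨F - 1, by have := f.pos; omega⟩
  have hx : (0 : ℝ) < ((n + 1).choose k : ℝ) := by exact_mod_cast Nat.choose_pos hk
  have hy : (n.choose k : ℝ) * (n + 1) = (n + 1).choose k * (n + 1 - k) := by
    have := Nat.choose_mul_succ_eq n k
    have h2 : (n.choose k : ℝ) * ((n + 1 : ℕ) : ℝ) = (n + 1).choose k * ((n + 1 - k : ℕ) : ℝ) := by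
      exact_mod_cast this
    rw [Nat.cast_sub hk] at h2
    push_cast at h2
    exact h2
  have hcard : ((Finset.powersetCard k (Finset.univ : Finset (Fin (n + 1)))).card : ℝ) =
      (n + 1).choose k := by simp
  have hnot : ∑ S ∈ Finset.powersetCard k (Finset.univ : Finset (Fin (n + 1))), indic (f ∉ S) =
      n.choose k := by
    rw [sum_indic, card_filter_notMem_powersetCard]; simp
  unfold finsetMean subsetProb
  rw [hcard, div_eq_iff hx.ne']
  by_cases hb : b
  · have h1 : ∀ S : Finset (Fin (n + 1)), indic (f ∈ S ↔ b) = 1 - indic (f ∉ S) := by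
      intro S; by_cases h : f ∈ S <;> simp [indic, h, hb]
    simp only [h1, Finset.sum_sub_distrib, hnot, indic_true hb, Finset.sum_const, nsmul_eq_mul,
      hcard]
    push_cast
    field_simp
    linarith
  · have h1 : ∀ S : Finset (Fin (n + 1)), indic (f ∈ S ↔ b) = indic (f ∉ S) := by
      intro S; by_cases h : f ∈ S <;> simp [indic, h, hb]
    simp only [h1, hnot, indic_false hb]
    push_cast
    field_simp
    linarith

/-- Sampling without replacement is negatively correlated. Both for membership (by
inclusion-exclusion) and for non-membership the claim reduces to C(n,k) C(n+2,k) ≤ C(n+1,k)². -/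
theorem mean_indic_mem_mem {F k : ℕ} (hk : k ≤ F) {f g : Fin F} (hfg : f ≠ g) (b : Prop) :
    finsetMean (Finset.powersetCard k (Finset.univ : Finset (Fin F)))
      (fun S => indic (f ∈ S ↔ b) * indic (g ∈ S ↔ b)) ≤ subsetProb F k b ^ 2 := by
  classical
  have hF : 2 ≤ F := by
    by_contra! h
    apply hfg
    ext
    have := f.2
    have := g.2
    omega
  obtain ⟨n, rfl⟩ : ∃ n, F = n + 2 := ⟨F - 2, by omega⟩
  have hx : (0 : ℝ) < ((n + 2).choose k : ℝ) := by exact_mod_cast Nat.choose_pos hk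
  have hy : ((n + 1).choose k : ℝ) * (n + 2) = (n + 2).choose k * (n + 2 - k) := by
    have := Nat.choose_mul_succ_eq (n + 1) k
    have h2 : ((n + 1).choose k : ℝ) * ((n + 2 : ℕ) : ℝ) =
        (n + 2).choose k * ((n + 2 - k : ℕ) : ℝ) := by
      exact_mod_cast this
    rw [Nat.cast_sub hk] at h2
    push_cast at h2
    exact h2
  have hz : (n.choose k : ℝ) * (n + 1) = (n + 1).choose k * (n + 1 - k) := by
    -- For k = n + 2 the natural subtraction truncates, but both binomial coefficients vanish.
    rcases Nat.lt_or_ge (n + 1) k with h | h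
    · rw [Nat.choose_eq_zero_of_lt h, Nat.choose_eq_zero_of_lt (by omega)]; simp
    · have := Nat.choose_mul_succ_eq n k
      have h2 : (n.choose k : ℝ) * ((n + 1 : ℕ) : ℝ) =
          (n + 1).choose k * ((n + 1 - k : ℕ) : ℝ) := by
        exact_mod_cast this
      rw [Nat.cast_sub h] at h2
      push_cast at h2
      exact h2
  have hcard : ((Finset.powersetCard k (Finset.univ : Finset (Fin (n + 2)))).card : ℝ) =
      (n + 2).choose k := by simp
  have hnot : ∀ f, ∑ S ∈ Finset.powersetCard k (Finset.univ : Finset (Fin (n + 2))),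
      indic (f ∉ S) = (n + 1).choose k := by
    intro f
    rw [sum_indic, card_filter_notMem_powersetCard]; simp
  have hnn : ∑ S ∈ Finset.powersetCard k (Finset.univ : Finset (Fin (n + 2))),
      indic (f ∉ S ∧ g ∉ S) = n.choose k := by
    rw [sum_indic, card_filter_notMem_notMem_powersetCard hfg]; simp
  set x : ℝ := ((n + 2).choose k : ℝ)
  set y : ℝ := ((n + 1).choose k : ℝ)
  set z : ℝ := (n.choose k : ℝ)
  have hy0 : 0 ≤ y := Nat.cast_nonneg _
  have hlog : z * x ≤ y ^ 2 := by
    have h1 : z * x * ((n + 1) * (n + 2)) ≤ y ^ 2 * ((n + 1) * (n + 2)) := by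
      have e1 : z * x * ((n + 1) * (n + 2)) = (z * (n + 1)) * (x * (n + 2)) := by ring
      have e2 : y ^ 2 * (((n : ℝ) + 1) * (n + 2)) = y * (y * (n + 2)) * (n + 1) := by ring
      rw [e1, e2, hz, hy]
      have e3 : y * (x * (n + 2 - k)) * (n + 1) - y * (n + 1 - k) * (x * (n + 2)) =
        y * x * k := by ring
      have : 0 ≤ y * x * k := by positivity
      linarith
    exact le_of_mul_le_mul_right h1 (by positivity)
  have hyx : (1 : ℝ) - k / ((n + 2 : ℕ) : ℝ) = y / x := by
    push_cast
    field_simp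
    linarith
  have hkx : (k : ℝ) / ((n + 2 : ℕ) : ℝ) = 1 - y / x := by linarith
  unfold finsetMean subsetProb
  rw [hcard, div_le_iff₀ hx]
  by_cases hb : b
  · have h1 : ∀ S : Finset (Fin (n + 2)), indic (f ∈ S ↔ b) * indic (g ∈ S ↔ b) =
        1 - indic (f ∉ S) - indic (g ∉ S) + indic (f ∉ S ∧ g ∉ S) := by
      intro S; by_cases h : f ∈ S <;> by_cases h' : g ∈ S <;> simp [indic, h, h', hb]
    simp only [h1, Finset.sum_sub_distrib, Finset.sum_add_distrib, hnot, hnn, indic_true hb,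
      Finset.sum_const, nsmul_eq_mul, hcard, mul_one, sub_self, zero_mul, add_zero, one_mul, hkx]
    have : (1 - y / x) ^ 2 * x = x - y - y + y ^ 2 / x := by field_simp; ring
    rw [this]
    have := (le_div_iff₀ hx).mpr hlog
    linarith
  · have h1 : ∀ S : Finset (Fin (n + 2)), indic (f ∈ S ↔ b) * indic (g ∈ S ↔ b) =
        indic (f ∉ S ∧ g ∉ S) := by
      intro S; by_cases h : f ∈ S <;> by_cases h' : g ∈ S <;> simp [indic, h, h', hb]
    simp only [h1, hnn, indic_false hb, sub_zero, zero_mul, zero_add, one_mul, hyx]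
    have : (y / x) ^ 2 * x = y ^ 2 / x := by field_simp
    rw [this]
    exact (le_div_iff₀ hx).mpr hlog

theorem finsetMean_piFinset_prod {ι α : Type*} [Fintype ι] [DecidableEq ι] (A : Finset α)
    (φ : ι → α → ℝ) :
    finsetMean (Fintype.piFinset fun _ : ι => A) (fun x => ∏ i, φ i (x i)) =
      ∏ i, finsetMean A (φ i) := by
  unfold finsetMean
  rw [Finset.sum_prod_piFinset, Fintype.card_piFinset, Finset.prod_div_distrib]
  push_cast
  rfl

theorem finsetMean_piFinset_apply {ι α : Type*} [Fintype ι] [DecidableEq ι] {A : Finset α}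
    (hA : A.Nonempty) (φ : α → ℝ) (i : ι) :
    finsetMean (Fintype.piFinset fun _ : ι => A) (fun x => φ (x i)) = finsetMean A φ := by
  have h1 : ∀ x : ι → α, φ (x i) = ∏ i', (if i' = i then φ else fun _ => 1) (x i') := by
    intro x
    rw [Finset.prod_eq_single i]
    · simp
    · intro i' _ h; simp [h]
    · simp
  simp only [h1]
  rw [finsetMean_piFinset_prod A fun i' => if i' = i then φ else fun _ => 1]
  rw [Finset.prod_eq_single i]
  · simp
  · intro i' _ h
    have : (A.card : ℝ) ≠ 0 := by exact_mod_cast hA.card_pos.ne'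
    simp [h, finsetMean, this]
  · simp

variable {KR N F : ℕ}

theorem receiverChoices_nonempty {μR : ℝ} (hμ : ⌊μR * F⌋₊ ≤ F) :
    (receiverChoices KR N F μR).Nonempty := by
  unfold receiverChoices
  rw [Fintype.piFinset_nonempty]
  intro _
  rw [Fintype.piFinset_nonempty]
  intro _
  rw [Finset.powersetCard_nonempty]
  simpa using hμ

/-- Independence of the receivers; their choices for the files other than n average out. -/
theorem mean_receiverChoices {μR : ℝ} (hμ : ⌊μR * F⌋₊ ≤ F) (n : Fin N)
    (φ : Fin KR → Finset (Fin F) → ℝ) :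
    finsetMean (receiverChoices KR N F μR) (fun s => ∏ j, φ j (s j n)) =
      ∏ j, finsetMean (Finset.powersetCard ⌊μR * F⌋₊ (Finset.univ : Finset (Fin F))) (φ j) := by
  unfold receiverChoices
  rw [finsetMean_piFinset_prod _ fun j (x : Fin N → Finset (Fin F)) => φ j (x n)]
  refine Finset.prod_congr rfl fun j _ => finsetMean_piFinset_apply ?_ _ _
  rw [Finset.powersetCard_nonempty]
  simpa using hμ

theorem indic_forall {ι : Type*} [Fintype ι] (p : ι → Prop) :
    indic (∀ i, p i) = ∏ i, indic (p i) := by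
  by_cases h : ∀ i, p i
  · rw [indic_true h, Finset.prod_eq_one fun i _ => indic_true (h i)]
  · rw [indic_false h]
    push Not at h
    obtain ⟨i, hi⟩ := h
    exact (Finset.prod_eq_zero (Finset.mem_univ i) (indic_false hi)).symm

theorem cachers_cacheOf (s : Fin KR → Fin N → Finset (Fin F)) (w : Packet N F)
    (L : Finset (Fin KR)) : cachers (cacheOf s) w = L ↔ ∀ j, (w.2 ∈ s j w.1 ↔ j ∈ L) := by
  simp [Finset.ext_iff, mem_cachers, cacheOf]

/-- The probability that a packet is cached exactly at the receivers in `L`. -/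
noncomputable def patternProb (F k : ℕ) (L : Finset (Fin KR)) : ℝ :=
  ((k : ℝ) / F) ^ L.card * (1 - k / F) ^ (KR - L.card)

theorem prod_subsetProb (F k : ℕ) (L : Finset (Fin KR)) :
    ∏ j, subsetProb F k (j ∈ L) = patternProb F k L := by
  classical
  have h1 : ∀ j, subsetProb F k (j ∈ L) = if j ∈ L then (k : ℝ) / F else 1 - k / F := by
    intro j
    by_cases h : j ∈ L <;> simp [subsetProb, indic, h]
  simp only [h1]
  rw [Finset.prod_ite, Finset.prod_const, Finset.prod_const, patternProb]
  congr 2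
  · simp
  · have : Finset.univ.filter (fun j => j ∉ L) = Lᶜ := by ext; simp
    rw [this, Finset.card_compl, Fintype.card_fin]

open Classical in
/-- The packets of file `n` that are cached exactly at the receivers in `L`. -/
noncomputable def patternSet (U : Fin KR → Finset (Packet N F)) (n : Fin N)
    (L : Finset (Fin KR)) : Finset (Fin F) :=
  Finset.univ.filter fun f : Fin F => cachers U (n, f) = L

theorem mem_patternSet {U : Fin KR → Finset (Packet N F)} {n : Fin N} {L : Finset (Fin KR)}
    {f : Fin F} : f ∈ patternSet U n L ↔ cachers U (n, f) = L := by
  simp [patternSet]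

/-- The number of packets of file `n` that are cached exactly at the receivers in `L`. -/
noncomputable def patternCount (U : Fin KR → Finset (Packet N F)) (n : Fin N)
    (L : Finset (Fin KR)) : ℕ :=
  (patternSet U n L).card

theorem patternCount_eq (s : Fin KR → Fin N → Finset (Fin F)) (n : Fin N) (L : Finset (Fin KR)) :
    (patternCount (cacheOf s) n L : ℝ) = ∑ f : Fin F, ∏ j, indic (f ∈ s j n ↔ j ∈ L) := by
  classical
  rw [patternCount, patternSet, ← sum_indic]
  refine Finset.sum_congr rfl fun f _ => ?_
  rw [← indic_forall]
  congr 1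
  exact propext (cachers_cacheOf s (n, f) L)

theorem finsetMean_sum {α ι : Type*} (S : Finset α) (T : Finset ι) (f : ι → α → ℝ) :
    finsetMean S (fun x => ∑ i ∈ T, f i x) = ∑ i ∈ T, finsetMean S (f i) := by
  unfold finsetMean
  rw [Finset.sum_comm, Finset.sum_div]

theorem mean_patternCount {μR : ℝ} (hμ : ⌊μR * F⌋₊ ≤ F) (n : Fin N) (L : Finset (Fin KR)) :
    finsetMean (receiverChoices KR N F μR) (fun s => (patternCount (cacheOf s) n L : ℝ)) =
      F * patternProb F ⌊μR * F⌋₊ L := by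
  simp only [patternCount_eq]
  rw [finsetMean_sum]
  have : ∀ f : Fin F, finsetMean (receiverChoices KR N F μR)
      (fun s => ∏ j, indic (f ∈ s j n ↔ j ∈ L)) = patternProb F ⌊μR * F⌋₊ L := by
    intro f
    rw [mean_receiverChoices hμ n fun j S => indic (f ∈ S ↔ j ∈ L), ← prod_subsetProb]
    exact Finset.prod_congr rfl fun j _ => mean_indic_mem hμ f _
  simp [this]

theorem patternProb_mem_Icc {F k : ℕ} (hk : k ≤ F) (L : Finset (Fin KR)) :
    0 ≤ patternProb F k L ∧ patternProb F k L ≤ 1 := by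
  have h1 : (k : ℝ) / F ≤ 1 := div_le_one_of_le₀ (by exact_mod_cast hk) (Nat.cast_nonneg _)
  have h2 : (0 : ℝ) ≤ (k : ℝ) / F := by positivity
  unfold patternProb
  constructor
  · have : 0 ≤ 1 - (k : ℝ) / F := by linarith
    positivity
  · exact mul_le_one₀ (pow_le_one₀ h2 h1) (pow_nonneg (by linarith) _)
      (pow_le_one₀ (by linarith) (by linarith))

/-- The F diagonal pairs contribute at most 1 each. Every other pair contributes at most p², by
negative correlation at each receiver and independence between receivers. The variance is therefore
at most F. -/
theorem mean_patternCount_sq_le {μR : ℝ} (hμ : ⌊μR * F⌋₊ ≤ F) (n : Fin N)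
    (L : Finset (Fin KR)) :
    finsetMean (receiverChoices KR N F μR) (fun s => (patternCount (cacheOf s) n L : ℝ) ^ 2) ≤
      F + (F * patternProb F ⌊μR * F⌋₊ L) ^ 2 := by
  set p := patternProb F ⌊μR * F⌋₊ L with hp
  obtain ⟨hp0, hp1⟩ := patternProb_mem_Icc hμ L
  simp only [patternCount_eq, pow_two, Finset.sum_mul_sum]
  rw [finsetMean_sum]
  simp only [finsetMean_sum]
  have hbound : ∀ f g : Fin F, finsetMean (receiverChoices KR N F μR)
      (fun s => (∏ j, indic (f ∈ s j n ↔ j ∈ L)) * ∏ j, indic (g ∈ s j n ↔ j ∈ L)) ≤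
      (if f = g then 1 else 0) + p ^ 2 := by
    intro f g
    simp only [← Finset.prod_mul_distrib]
    rw [mean_receiverChoices hμ n fun j S => indic (f ∈ S ↔ j ∈ L) * indic (g ∈ S ↔ j ∈ L)]
    by_cases hfg : f = g
    · subst hfg
      simp only [indic_mul_self, if_true]
      rw [Finset.prod_congr rfl fun j _ => mean_indic_mem hμ f (j ∈ L), prod_subsetProb, ← hp]
      nlinarith [sq_nonneg p]
    · rw [if_neg hfg, zero_add, hp, ← prod_subsetProb, ← Finset.prod_pow]
      refine Finset.prod_le_prod (fun j _ => ?_) fun j _ => mean_indic_mem_mem hμ hfg _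
      exact div_nonneg (Finset.sum_nonneg fun _ _ => mul_nonneg (indic_nonneg _) (indic_nonneg _))
        (Nat.cast_nonneg _)
  calc _ ≤ ∑ f : Fin F, ∑ g : Fin F, ((if f = g then (1 : ℝ) else 0) + p ^ 2) :=
        Finset.sum_le_sum fun f _ => Finset.sum_le_sum fun g _ => hbound f g
    _ = _ := by
        simp [Finset.sum_add_distrib]
        ring

open Classical in
/-- Chebyshev's inequality for the number of packets with a given cache pattern. -/
theorem card_patternCount_gt_le {μR : ℝ} (hμ : ⌊μR * F⌋₊ ≤ F) (hF : 1 ≤ F) {η : ℝ} (hη : 0 < η)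
    (n : Fin N) (L : Finset (Fin KR)) :
    ((((receiverChoices KR N F μR).filter fun s =>
      ¬ (patternCount (cacheOf s) n L : ℝ) ≤ F * (patternProb F ⌊μR * F⌋₊ L + η)).card : ℝ)) ≤
      (receiverChoices KR N F μR).card / (η ^ 2 * F) := by
  set p := patternProb F ⌊μR * F⌋₊ L
  set Ω := receiverChoices KR N F μR
  set X : (Fin KR → Fin N → Finset (Fin F)) → ℝ := fun s => (patternCount (cacheOf s) n L : ℝ)
  have hΩ : (0 : ℝ) < Ω.card := by exact_mod_cast (receiverChoices_nonempty hμ).card_pos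
  have hF0 : (0 : ℝ) < F := by exact_mod_cast hF
  have h1 : ∑ s ∈ Ω, X s = F * p * Ω.card := by
    have := mean_patternCount hμ n L
    rwa [finsetMean, div_eq_iff hΩ.ne'] at this
  have h2 : ∑ s ∈ Ω, X s ^ 2 ≤ (F + (F * p) ^ 2) * Ω.card := by
    have := mean_patternCount_sq_le hμ n L
    rwa [finsetMean, div_le_iff₀ hΩ] at this
  have hvar : ∑ s ∈ Ω, (X s - F * p) ^ 2 ≤ F * Ω.card := by
    have : ∑ s ∈ Ω, (X s - F * p) ^ 2 =
        ∑ s ∈ Ω, X s ^ 2 - 2 * (F * p) * ∑ s ∈ Ω, X s + (F * p) ^ 2 * Ω.card := by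
      simp only [sub_sq, Finset.sum_add_distrib, Finset.sum_sub_distrib, Finset.sum_const,
        nsmul_eq_mul, Finset.mul_sum]
      congr 1
      · congr 1
        exact Finset.sum_congr rfl fun s _ => by ring
      · ring
    rw [this, h1]
    linarith
  rw [le_div_iff₀ (by positivity)]
  have hmarkov : ((Ω.filter fun s => ¬ X s ≤ F * (p + η)).card : ℝ) * (F * η) ^ 2 ≤
      F * Ω.card := by
    refine le_trans ?_ hvar
    calc _ = ∑ s ∈ Ω.filter fun s => ¬ X s ≤ F * (p + η), (F * η) ^ 2 := by simp
      _ ≤ ∑ s ∈ Ω.filter fun s => ¬ X s ≤ F * (p + η), (X s - F * p) ^ 2 := by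
          refine Finset.sum_le_sum fun s hs => ?_
          have hs2 := (Finset.mem_filter.mp hs).2
          have : 0 ≤ F * η := by positivity
          exact pow_le_pow_left₀ this (by linarith) 2
      _ ≤ _ := Finset.sum_le_sum_of_subset_of_nonneg (Finset.filter_subset _ _)
          fun _ _ _ => sq_nonneg _
  have : F * (((Ω.filter fun s => ¬ X s ≤ F * (p + η)).card : ℝ) * (η ^ 2 * F)) ≤
      F * Ω.card := by
    refine le_trans (le_of_eq ?_) hmarkov
    ring
  exact le_of_mul_le_mul_left this hF0

theorem decentralizedProb_le_one (μR : ℝ) (E : (Fin KR → Finset (Packet N F)) → Prop) :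
    decentralizedProb KR N F μR E ≤ 1 := by
  classical
  refine div_le_one_of_le₀ ?_ (Nat.cast_nonneg _)
  exact_mod_cast Finset.card_filter_le _ _

/-- With high probability, no cache pattern is much more frequent than expected. -/
theorem le_decentralizedProb {μR : ℝ} (hμ : ⌊μR * F⌋₊ ≤ F) (hF : 1 ≤ F) {η : ℝ} (hη : 0 < η)
    {E : (Fin KR → Finset (Packet N F)) → Prop}
    (hE : ∀ s ∈ receiverChoices KR N F μR, (∀ n L, (patternCount (cacheOf s) n L : ℝ) ≤
      F * (patternProb F ⌊μR * F⌋₊ L + η)) → E (cacheOf s)) :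
    1 - N * 2 ^ KR / (η ^ 2 * F) ≤ decentralizedProb KR N F μR E := by
  classical
  set Ω := receiverChoices KR N F μR
  have hΩ : (0 : ℝ) < Ω.card := by exact_mod_cast (receiverChoices_nonempty hμ).card_pos
  unfold decentralizedProb
  rw [le_div_iff₀ hΩ]
  let bad : Fin N × Finset (Fin KR) → Finset (Fin KR → Fin N → Finset (Fin F)) := fun x =>
    Ω.filter fun s => ¬ (patternCount (cacheOf s) x.1 x.2 : ℝ) ≤
      F * (patternProb F ⌊μR * F⌋₊ x.2 + η)
  have hsub : Ω.filter (fun s => ¬ E (cacheOf s)) ⊆ Finset.univ.biUnion bad := by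
    intro s hs
    obtain ⟨hs1, hs2⟩ := Finset.mem_filter.mp hs
    by_contra hcon
    apply hs2
    apply hE s hs1
    intro n L
    by_contra hnl
    exact hcon (Finset.mem_biUnion.mpr ⟨(n, L), Finset.mem_univ _, Finset.mem_filter.mpr ⟨hs1, hnl⟩⟩)
  have hbad : ((Ω.filter (fun s => ¬ E (cacheOf s))).card : ℝ) ≤
      N * 2 ^ KR * (Ω.card / (η ^ 2 * F)) := by
    calc ((Ω.filter (fun s => ¬ E (cacheOf s))).card : ℝ) ≤ ∑ x, ((bad x).card : ℝ) := by
          exact_mod_cast (Finset.card_le_card hsub).trans Finset.card_biUnion_le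
      _ ≤ ∑ _x : Fin N × Finset (Fin KR), (Ω.card : ℝ) / (η ^ 2 * F) :=
          Finset.sum_le_sum fun x _ => card_patternCount_gt_le hμ hF hη x.1 x.2
      _ = _ := by simp
  have hsplit : ((Ω.filter fun s => E (cacheOf s)).card : ℝ) +
      (Ω.filter fun s => ¬ E (cacheOf s)).card = Ω.card := by
    exact_mod_cast Finset.card_filter_add_card_filter_not (s := Ω) (fun s => E (cacheOf s))
  have : (1 - N * 2 ^ KR / (η ^ 2 * F)) * Ω.card =
      Ω.card - N * 2 ^ KR * (Ω.card / (η ^ 2 * F)) := by ring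
  rw [this]
  have hg : ((Ω.filter fun s => E (cacheOf s)).card : ℝ) =
      Ω.card - (Ω.filter fun s => ¬ E (cacheOf s)).card := by linarith
  have hgoal : (Ω.card : ℝ) - N * 2 ^ KR * (Ω.card / (η ^ 2 * F)) ≤
      (Ω.filter fun s => E (cacheOf s)).card := by rw [hg]; linarith
  convert hgoal

end Concentration

/-! ### Covering requests by symmetric families of patterns -/

section Patterns

theorem exists_index {α : Type*} (A : Finset α) :
    ∃ f : α → ℕ, Set.InjOn f A ∧ ∀ a ∈ A, f a < A.card := by
  classical
  refine ⟨fun a => if h : a ∈ A then A.equivFin ⟨a, h⟩ else 0, ?_, ?_⟩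
  · intro a ha b hb hab
    have ha' : a ∈ A := ha
    have hb' : b ∈ A := hb
    simp only [dif_pos ha', dif_pos hb'] at hab
    simpa using A.equivFin.injective (Fin.ext hab)
  · intro a ha
    simp [ha]

theorem exists_enum {α : Type*} {A : Finset α} {c : ℕ} (hc : 1 ≤ c) (hA : c ≤ A.card) :
    ∃ g : ℕ → α, (∀ k, g k ∈ A) ∧ ∀ k < c, ∀ k' < c, g k = g k' → k = k' := by
  have hA0 : 0 < A.card := by omega
  refine ⟨fun k => A.equivFin.symm ⟨k % A.card, Nat.mod_lt _ hA0⟩, fun k => Subtype.property _, ?_⟩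
  intro k hk k' hk' h
  have := A.equivFin.symm.injective (Subtype.ext h)
  simp only [Fin.mk.injEq] at this
  rwa [Nat.mod_eq_of_lt (by omega), Nat.mod_eq_of_lt (by omega)] at this

/-- If every type occurs in at least `c` of the patterns and there are at most `M` requests of each
type, then `M / c + 1` copies of every pattern suffice for all the requests. -/
theorem exists_pattern_cover {R ι τ : Type*} [Fintype τ] (D : Finset R) (ty : R → ι)
    (E : τ → ι → Prop) {c M : ℕ} (hc : 1 ≤ c)
    (hcov : ∀ r ∈ D, ∃ T : Finset τ, c ≤ T.card ∧ ∀ σ ∈ T, E σ (ty r))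
    (hM : ∀ r ∈ D, ∀ S ⊆ D, (∀ r' ∈ S, ty r' = ty r) → S.card ≤ M) :
    ∃ B : τ × Fin (M / c + 1) → Finset R,
      (∀ b, B b ⊆ D ∧ (∀ r ∈ B b, E b.1 (ty r)) ∧ Set.InjOn ty (B b : Set R)) ∧
      ∀ r ∈ D, ∃ b, r ∈ B b := by
  classical
  choose idx hinj hlt using fun t : ι => exists_index (D.filter fun r' => ty r' = t)
  have henum : ∀ (t : ι) (_ : ∃ T : Finset τ, c ≤ T.card ∧ ∀ σ ∈ T, E σ t), ∃ g : ℕ → τ,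
      (∀ k, E (g k) t) ∧ ∀ k < c, ∀ k' < c, g k = g k' → k = k' := by
    rintro t ⟨T, hT, hE⟩
    obtain ⟨g, h1, h2⟩ := exists_enum hc hT
    exact ⟨g, fun k => hE _ (h1 k), h2⟩
  choose g hg hg' using henum
  have hidx : ∀ r ∈ D, idx (ty r) r < M := fun r hr =>
    (hlt (ty r) r (Finset.mem_filter.mpr ⟨hr, rfl⟩)).trans_le
      (hM r hr _ (Finset.filter_subset _ _) fun r' hr' => (Finset.mem_filter.mp hr').2)
  -- The request with index k among those of its type goes to the pattern numbered k mod c for that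
  -- type, in copy k / c. Pattern and copy determine k, so a block holds at most one request of each
  -- type.
  refine ⟨fun b => D.filter fun r => ∃ hr : r ∈ D,
    g (ty r) (hcov r hr) (idx (ty r) r % c) = b.1 ∧ idx (ty r) r / c = b.2, ?_, ?_⟩
  · intro b
    refine ⟨Finset.filter_subset _ _, ?_, ?_⟩
    · intro r hr
      obtain ⟨-, hrD, h1, -⟩ := Finset.mem_filter.mp hr
      rw [← h1]
      exact hg (ty r) (hcov r hrD) _
    · intro r hr r' hr' hty
      obtain ⟨-, hrD, h1, h2⟩ := Finset.mem_filter.mp (Finset.mem_coe.mp hr)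
      obtain ⟨-, hrD', h1', h2'⟩ := Finset.mem_filter.mp (Finset.mem_coe.mp hr')
      have h3 : g (ty r) (hcov r hrD) (idx (ty r) r % c) =
          g (ty r) (hcov r hrD) (idx (ty r) r' % c) := by
        rw [h1, ← h1']
        simp only [hty]
      have h4 := hg' _ _ _ (Nat.mod_lt _ hc) _ (Nat.mod_lt _ hc) h3
      have h5 : idx (ty r) r / c = idx (ty r) r' / c := by rw [h2, ← h2', hty]
      apply hinj (ty r)
      · simp [hrD]
      · simp [hrD', hty]
      · rw [← Nat.div_add_mod (idx (ty r) r) c, h4, h5, Nat.div_add_mod]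
  · intro r hr
    refine ⟨(g (ty r) (hcov r hr) (idx (ty r) r % c), ⟨idx (ty r) r / c, ?_⟩), ?_⟩
    · exact Nat.lt_succ_of_le (Nat.div_le_div_right (hidx r hr).le)
    · exact Finset.mem_filter.mpr ⟨hr, hr, rfl, rfl⟩

/-- A finite set can be coloured with `K` colours such that no colour is used more than
`A.card / K + 1` times. -/
theorem exists_balanced_colouring {α : Type*} (A : Finset α) {K : ℕ} (hK : 0 < K) :
    ∃ f : α → Fin K, ∀ c, ∀ S ⊆ A, (∀ a ∈ S, f a = c) → S.card ≤ A.card / K + 1 := by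
  classical
  obtain ⟨g, hinj, hlt⟩ := exists_index A
  refine ⟨fun a => ⟨g a % K, Nat.mod_lt _ hK⟩, fun c S hSA hS => ?_⟩
  rw [← Finset.card_range (A.card / K + 1)]
  apply Finset.card_le_card_of_injOn fun a => g a / K
  · intro a ha
    simp only [Finset.coe_range, Set.mem_Iio]
    exact Nat.lt_succ_of_le (Nat.div_le_div_right (hlt a (hSA ha)).le)
  · intro a ha b hb hab
    have h1 : g a % K = c := congrArg Fin.val (hS a ha)
    have h2 : g b % K = c := congrArg Fin.val (hS b hb)
    apply hinj (hSA ha) (hSA hb)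
    have hab' : g a / K = g b / K := hab
    rw [← Nat.div_add_mod (g a) K, h1, ← h2, hab', Nat.div_add_mod]

/-- The pairs of an element and an `l`-set that does not contain it. -/
def pointedSets (K l : ℕ) : Finset (Σ _ : Fin K, Finset (Fin K)) :=
  Finset.univ.sigma fun i => Finset.powersetCard l (Finset.univ.erase i)

theorem mem_pointedSets {K l : ℕ} {x : Σ _ : Fin K, Finset (Fin K)} :
    x ∈ pointedSets K l ↔ x.1 ∉ x.2 ∧ x.2.card = l := by
  simp [pointedSets, Finset.mem_powersetCard, Finset.subset_erase]

theorem card_pointedSets (K l : ℕ) : (pointedSets K l).card = K * (K - 1).choose l := by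
  simp [pointedSets, Finset.card_sigma, Finset.card_powersetCard]

/-- The action of a permutation on pairs of an element and a set. -/
def mapPointed {K : ℕ} (σ : Equiv.Perm (Fin K)) (x : Σ _ : Fin K, Finset (Fin K)) :
    Σ _ : Fin K, Finset (Fin K) :=
  ⟨σ x.1, x.2.map σ.toEmbedding⟩

theorem mapPointed_mem {K l : ℕ} (σ : Equiv.Perm (Fin K)) {x : Σ _ : Fin K, Finset (Fin K)}
    (hx : x ∈ pointedSets K l) : mapPointed σ x ∈ pointedSets K l := by
  rw [mem_pointedSets] at hx ⊢
  simpa [mapPointed] using hx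

theorem mapPointed_mul {K : ℕ} (σ τ : Equiv.Perm (Fin K)) (x : Σ _ : Fin K, Finset (Fin K)) :
    mapPointed (σ * τ) x = mapPointed σ (mapPointed τ x) := by
  simp only [mapPointed, Equiv.Perm.mul_apply, Finset.map_map]
  rfl

/-- A permutation extending a bijection of the sets sends the first point outside the second set; a
transposition of two points outside that set then corrects it. -/
theorem exists_mapPointed_eq {K l : ℕ} {x y : Σ _ : Fin K, Finset (Fin K)}
    (hx : x ∈ pointedSets K l) (hy : y ∈ pointedSets K l) : ∃ σ, mapPointed σ x = y := by
  classical
  obtain ⟨i, W⟩ := x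
  obtain ⟨j, L⟩ := y
  rw [mem_pointedSets] at hx hy
  simp only at hx hy
  let e : {a // a ∈ W} ≃ {a // a ∈ L} := Finset.equivOfCardEq (hx.2.trans hy.2.symm)
  let τ : Equiv.Perm (Fin K) := e.extendSubtype
  have hτ : W.map τ.toEmbedding = L := by
    apply Finset.eq_of_subset_of_card_le
    · intro a ha
      obtain ⟨b, hb, rfl⟩ := Finset.mem_map.mp ha
      exact e.extendSubtype_mem b hb
    · rw [Finset.card_map, hx.2, hy.2]
  have hτi : τ i ∉ L := by
    rw [← hτ]
    simpa using hx.1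
  refine ⟨Equiv.swap (τ i) j * τ, ?_⟩
  rw [mapPointed_mul]
  simp only [mapPointed, hτ, Equiv.swap_apply_left]
  congr 1
  ext a
  simp only [Finset.mem_map_equiv, Equiv.symm_swap]
  by_cases h1 : a = τ i
  · subst h1; simp [hτi, hy.1]
  · by_cases h2 : a = j
    · subst h2; simp [hτi, hy.1]
    · rw [Equiv.swap_apply_of_ne_of_ne h1 h2]

theorem mul_choose_dvd_factorial {K l : ℕ} (hl : l < K) :
    K * (K - 1).choose l ∣ K.factorial := by
  rw [← Nat.mul_factorial_pred (by omega : K ≠ 0)]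
  apply Nat.mul_dvd_mul_left
  rw [← Nat.choose_mul_factorial_mul_factorial (by omega : l ≤ K - 1), mul_assoc]
  exact Nat.dvd_mul_right _ _

/-- The number of permutations that map one pointed `l`-set to another. -/
theorem card_mapPointed_eq {K l : ℕ} {x y : Σ _ : Fin K, Finset (Fin K)}
    (hx : x ∈ pointedSets K l) (hy : y ∈ pointedSets K l) :
    (Finset.univ.filter fun σ => mapPointed σ x = y).card * (K * (K - 1).choose l) =
      K.factorial := by
  classical
  have h1 := Finset.card_eq_sum_card_fiberwise (f := fun σ => mapPointed σ x)
    (s := (Finset.univ : Finset (Equiv.Perm (Fin K)))) (t := pointedSets K l)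
    (fun σ _ => mapPointed_mem σ hx)
  -- By transitivity, left multiplication carries each fibre injectively into any other, so all
  -- fibres have the same size.
  have h2 : ∀ y' ∈ pointedSets K l, (Finset.univ.filter fun σ => mapPointed σ x = y').card =
      (Finset.univ.filter fun σ => mapPointed σ x = y).card := by
    intro y' hy'
    obtain ⟨β, hβ⟩ := exists_mapPointed_eq hy' hy
    obtain ⟨γ, hγ⟩ := exists_mapPointed_eq hy hy'
    apply le_antisymm
    · apply Finset.card_le_card_of_injOn fun σ => β * σ
      · intro σ hσ
        simp only [Finset.coe_filter, Finset.mem_univ, true_and, Set.mem_ofPred_eq] at hσ ⊢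
        rw [mapPointed_mul, hσ, hβ]
      · exact fun σ _ τ _ h => mul_left_cancel h
    · apply Finset.card_le_card_of_injOn fun σ => γ * σ
      · intro σ hσ
        simp only [Finset.coe_filter, Finset.mem_univ, true_and, Set.mem_ofPred_eq] at hσ ⊢
        rw [mapPointed_mul, hσ, hγ]
      · exact fun σ _ τ _ h => mul_left_cancel h
  rw [Finset.sum_congr rfl h2, Finset.sum_const, card_pointedSets, Finset.card_univ,
    Fintype.card_perm, Fintype.card_fin, smul_eq_mul] at h1
  rw [h1, mul_comm]

end Patterns

/-! ### Delivery schedules on the two subchannels -/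

section Schedules

variable {KT KR N F : ℕ}

theorem exists_isSchedule_of_fintype {feas : Finset (Request KR N F) → Prop}
    {D : Finset (Request KR N F)} {κ : Type*} [Fintype κ] (B : κ → Finset (Request KR N F))
    (hB : ∀ b, B b ⊆ D ∧ Set.InjOn Prod.fst (B b : Set (Request KR N F)) ∧
      Set.InjOn Prod.snd (B b : Set (Request KR N F)) ∧ feas (B b))
    (hcov : ∀ r ∈ D, ∃ b, r ∈ B b) :
    ∃ B' : Fin (Fintype.card κ) → Finset (Request KR N F),
      IsSchedule feas D (Fintype.card κ) B' := by
  let e := (Fintype.equivFin κ).symm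
  refine ⟨fun m => B (e m), fun m => hB (e m), fun r hr => ?_⟩
  obtain ⟨b, hb⟩ := hcov r hr
  exact ⟨e.symm b, by simpa using hb⟩

/-- Requests can be scheduled separately for every number of receivers that cache the packet. -/
theorem exists_isSchedule_of_levels {feas : Finset (Request KR N F) → Prop}
    {d : Fin KR → Fin N} {U : Fin KR → Finset (Packet N F)} (κ : Fin KR → Type)
    [∀ l, Fintype (κ l)]
    (h : ∀ l : Fin KR, ∃ B : κ l → Finset (Request KR N F),
      (∀ b, (∀ r ∈ B b, r ∈ requests d U ∧ (cachers U r.2).card = l) ∧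
        Set.InjOn Prod.fst (B b : Set (Request KR N F)) ∧
        Set.InjOn Prod.snd (B b : Set (Request KR N F)) ∧ feas (B b)) ∧
      ∀ r ∈ requests d U, (cachers U r.2).card = l → ∃ b, r ∈ B b) :
    ∃ B : Fin (∑ l, Fintype.card (κ l)) → Finset (Request KR N F),
      IsSchedule feas (requests d U) (∑ l, Fintype.card (κ l)) B := by
  choose B hB hcov using h
  rw [← Fintype.card_sigma]
  refine exists_isSchedule_of_fintype (fun b : Σ l, κ l => B b.1 b.2) ?_ ?_
  · rintro ⟨l, b⟩
    exact ⟨fun r hr => ((hB l b).1 r hr).1, (hB l b).2⟩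
  · intro r hr
    have hlt : (cachers U r.2).card < KR := by
      have : (cachers U r.2).card < (Finset.univ : Finset (Fin KR)).card :=
        Finset.card_lt_card (Finset.ssubset_univ_iff.mpr fun h => by
          have h1 : r.1 ∈ cachers U r.2 := h ▸ Finset.mem_univ _
          exact (mem_requests.mp hr).2 (mem_cachers.mp h1))
      simpa using this
    obtain ⟨b, hb⟩ := hcov ⟨_, hlt⟩ r hr rfl
    exact ⟨⟨_, b⟩, hb⟩

/-- One receiver requests a single file, so its requests are told apart by their packets. This turns
bounds on pattern counts into bounds on the number of requests of one type. -/
theorem exists_packets_of_requests {d : Fin KR → Fin N} {U : Fin KR → Finset (Packet N F)}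
    {j : Fin KR} {L : Finset (Fin KR)} {S : Finset (Request KR N F)} (hSD : S ⊆ requests d U)
    (hS : ∀ r ∈ S, r.1 = j ∧ cachers U r.2 = L) :
    ∃ T ⊆ patternSet U (d j) L, T.card = S.card ∧ ∀ f ∈ T, ∃ r ∈ S, r.2 = (d j, f) := by
  classical
  have hr2 : ∀ r ∈ S, r.2 = (d j, r.2.2) := fun r hr => by
    have := (mem_requests.mp (hSD hr)).1
    rw [(hS r hr).1] at this
    exact Prod.ext this rfl
  refine ⟨S.image fun r => r.2.2, ?_, ?_, ?_⟩
  · intro f hf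
    obtain ⟨r, hr, rfl⟩ := Finset.mem_image.mp hf
    rw [mem_patternSet, ← hr2 r hr]
    exact (hS r hr).2
  · apply Finset.card_image_of_injOn
    intro r hr r' hr' h
    have h' : r.2.2 = r'.2.2 := h
    refine Prod.ext ((hS r hr).1.trans (hS r' hr').1.symm) ?_
    rw [hr2 r hr, hr2 r' hr', h']
  · intro f hf
    obtain ⟨r, hr, rfl⟩ := Finset.mem_image.mp hf
    exact ⟨r, hr, hr2 r hr⟩

/-- Coded multicasting on the subchannel without CSIT. -/
theorem exists_scheduleN {νn : Measure (Channel KT KR)} (hν : νn ≪ volume)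
    {P : Fin KT → Finset (Packet N F)} (hP : ∀ w, (transmitters P w).Nonempty)
    {d : Fin KR → Fin N} {U : Fin KR → Finset (Packet N F)} {M : ℕ → ℕ}
    (hM : ∀ n L, patternCount U n L ≤ M L.card) :
    ∃ B : Fin (∑ l : Fin KR, KR.choose (l + 1) * (M l + 1)) → Finset (Request KR N F),
      IsSchedule (FeasibleN νn P U) (requests d U)
        (∑ l : Fin KR, KR.choose (l + 1) * (M l + 1)) B := by
  classical
  let τ : Fin KR → Type := fun l =>
    {S : Finset (Fin KR) // S ∈ Finset.powersetCard (l + 1) Finset.univ}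
  have hcard : ∀ l : Fin KR, Fintype.card (τ l × Fin (M l / 1 + 1)) =
      KR.choose (l + 1) * (M l + 1) := by
    intro l
    simp only [τ]
    rw [Fintype.card_prod, Fintype.card_coe, Finset.card_powersetCard]
    simp
  have main := exists_isSchedule_of_levels (feas := FeasibleN νn P U) (d := d) (U := U)
    (fun l => τ l × Fin (M l / 1 + 1)) ?_
  · rw [Finset.sum_congr rfl fun l _ => hcard l] at main
    exact main
  intro l
  let D := (requests d U).filter fun r => (cachers U r.2).card = l
  -- A request of receiver j with cachers L fits only the set L ∪ {j}; hence c = 1 in the covering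
  -- lemma.
  let E : τ l → Fin KR × Finset (Fin KR) → Prop := fun S t => t.1 ∈ S.1 ∧ t.2 = S.1.erase t.1
  have hcount : ∀ r ∈ D, ∃ T : Finset (τ l), 1 ≤ T.card ∧
      ∀ S ∈ T, E S (r.1, cachers U r.2) := by
    intro r hr
    obtain ⟨hr1, hr2⟩ := Finset.mem_filter.mp hr
    have hnot : r.1 ∉ cachers U r.2 := fun hc => (mem_requests.mp hr1).2 (mem_cachers.mp hc)
    have hmem : insert r.1 (cachers U r.2) ∈ Finset.powersetCard (l + 1) Finset.univ := by
      rw [Finset.mem_powersetCard]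
      exact ⟨Finset.subset_univ _, by rw [Finset.card_insert_of_notMem hnot, hr2]⟩
    refine ⟨{⟨insert r.1 (cachers U r.2), hmem⟩}, by simp, fun S hS => ?_⟩
    · rw [Finset.mem_singleton] at hS
      subst hS
      exact ⟨Finset.mem_insert_self _ _, (Finset.erase_insert hnot).symm⟩
  have hpop : ∀ r ∈ D, ∀ S ⊆ D,
      (∀ r' ∈ S, (r'.1, cachers U r'.2) = (r.1, cachers U r.2)) → S.card ≤ M l := by
    intro r hr S hSD hS
    obtain ⟨hr1, hr2⟩ := Finset.mem_filter.mp hr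
    obtain ⟨T, hT, hTS, -⟩ := exists_packets_of_requests
      (fun r' hr' => (Finset.mem_filter.mp (hSD hr')).1)
      (fun r' hr' => Prod.mk.inj (hS r' hr'))
    rw [← hTS, ← hr2]
    exact (Finset.card_le_card hT).trans (hM _ _)
  obtain ⟨B, hB, hcov⟩ := exists_pattern_cover D (fun r => (r.1, cachers U r.2)) E le_rfl
    hcount hpop
  refine ⟨B, fun b => ?_, fun r hr hl => hcov r (Finset.mem_filter.mpr ⟨hr, hl⟩)⟩
  obtain ⟨hsub, hE, hinj⟩ := hB b
  have hmem : ∀ r ∈ B b, r ∈ requests d U ∧ (cachers U r.2).card = l :=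
    fun r hr => Finset.mem_filter.mp (hsub hr)
  have hfst : Set.InjOn Prod.fst (B b : Set (Request KR N F)) := by
    intro r hr r' hr' h
    apply hinj hr hr'
    have h1 : cachers U r.2 = b.1.1.erase r.1 := (hE r hr).2
    have h2 : cachers U r'.2 = b.1.1.erase r'.1 := (hE r' hr').2
    simp only [h1, h2, h]
  have hsnd : Set.InjOn Prod.snd (B b : Set (Request KR N F)) := by
    intro r hr r' hr' h
    apply hfst hr hr'
    -- A receiver caches the packets meant for the others in its block but not its own, so the same
    -- packet cannot serve two of them.
    by_contra hne
    have h1 : r.1 ∉ cachers U r.2 := fun hc =>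
      (mem_requests.mp (hmem r hr).1).2 (mem_cachers.mp hc)
    apply h1
    have h2 : cachers U r'.2 = b.1.1.erase r'.1 := (hE r' hr').2
    rw [h, h2]
    exact Finset.mem_erase.mpr ⟨hne, (hE r hr).1⟩
  refine ⟨hmem, hfst, hsnd, feasibleN_of_clique hν
    (fun r hr => (mem_requests.mp (hmem r hr).1).2) hsnd (fun r _ => hP r.2) ?_⟩
  intro r hr s hs hsr
  rw [← mem_cachers]
  have h2 : cachers U s.2 = b.1.1.erase s.1 := (hE s hs).2
  rw [h2]
  exact Finset.mem_erase.mpr ⟨fun h => hsr (hfst hs hr h.symm), (hE r hr).1⟩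

/-- The number of blocks used on the subchannel with perfect CSIT for the packets that are cached
at `l` receivers. -/
def blocksP (K m l M : ℕ) : ℕ :=
  K.factorial * K *
    ((M / K + 1) / (min (m + l) K * (K.factorial / (K * (K - 1).choose l))) + 1)

/-- Joint zero-forcing and cache-aided interference cancellation on the subchannel with perfect
CSIT. -/
theorem exists_scheduleP {νp : Measure (Channel KT KR)} (hν : νp ≪ volume)
    {P : Fin KT → Finset (Packet N F)} {m : ℕ} (hm : 1 ≤ m)
    (hP : ∀ w, m ≤ (transmitters P w).card)
    {d : Fin KR → Fin N} {U : Fin KR → Finset (Packet N F)} {M : ℕ → ℕ}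
    (hM : ∀ n L, patternCount U n L ≤ M L.card) :
    ∃ B : Fin (∑ l : Fin KR, blocksP KR m l (M l)) → Finset (Request KR N F),
      IsSchedule (FeasibleP νp P U) (requests d U) (∑ l : Fin KR, blocksP KR m l (M l)) B := by
  classical
  let X : ℕ → ℕ := fun l => KR.factorial / (KR * (KR - 1).choose l)
  let κ : Fin KR → Type := fun l => (Equiv.Perm (Fin KR) × Fin KR) ×
    Fin ((M l / KR + 1) / (min (m + l) KR * X l) + 1)
  have hcard : ∀ l : Fin KR, Fintype.card (κ l) = blocksP KR m l (M l) := by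
    intro l
    simp only [κ, Fintype.card_prod, Fintype.card_perm, Fintype.card_fin, blocksP, X]
  have main := exists_isSchedule_of_levels (feas := FeasibleP νp P U) (d := d) (U := U) κ ?_
  · rw [Finset.sum_congr rfl fun l _ => hcard l] at main
    exact main
  intro l
  have hKR : 0 < KR := l.pos
  have : NeZero KR := ⟨hKR.ne'⟩
  obtain ⟨n, hn⟩ : ∃ n, n = min (m + l) KR := ⟨_, rfl⟩
  have hln : (l : ℕ) + 1 ≤ n := by have := l.2; omega
  have hnK : n ≤ KR := by omega
  have hnm : n ≤ m + l := by omega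
  have hXmul : X l * (KR * (KR - 1).choose l) = KR.factorial :=
    Nat.div_mul_cancel (mul_choose_dvd_factorial l.2)
  have hXpos : 1 ≤ X l := by
    rcases Nat.eq_zero_or_pos (X l) with h | h
    · rw [h, zero_mul] at hXmul
      exact absurd hXmul.symm (Nat.factorial_ne_zero _)
    · exact h
  have hXeq : ∀ x ∈ pointedSets KR l, ∀ y ∈ pointedSets KR l,
      (Finset.univ.filter fun σ => mapPointed σ x = y).card = X l := by
    intro x hx y hy
    have h1 := card_mapPointed_eq hx hy
    rw [← hXmul] at h1
    refine Nat.eq_of_mul_eq_mul_right (Nat.pos_of_ne_zero fun h0 => ?_) h1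
    rw [h0, mul_zero] at hXmul
    exact absurd hXmul.symm (Nat.factorial_ne_zero _)
  -- The template block: the receivers in A are served, receiver i with a packet cached exactly at W
  -- i ⊆ A \ {i}.
  let A : Finset (Fin KR) := Finset.univ.filter fun i => (i : ℕ) < n
  have hA : A.card = n := by
    have : A = (Finset.univ : Finset (Fin n)).map (Fin.castLEEmb hnK) := by
      ext i
      simp only [A, Finset.mem_filter, Finset.mem_univ, true_and, Finset.mem_map]
      constructor
      · intro hi
        exact ⟨⟨i, hi⟩, rfl⟩
      · rintro ⟨i', rfl⟩
        exact i'.2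
    rw [this, Finset.card_map, Finset.card_univ, Fintype.card_fin]
  have hW : ∀ i : Fin KR, ∃ W ⊆ A.erase i, W.card = l := by
    intro i
    apply Finset.exists_subset_card_eq
    have := Finset.pred_card_le_card_erase (s := A) (a := i)
    omega
  choose W hWA hWl using hW
  have hWpt : ∀ i, (⟨i, W i⟩ : Σ _ : Fin KR, Finset (Fin KR)) ∈ pointedSets KR l := by
    intro i
    rw [mem_pointedSets]
    exact ⟨fun h => Finset.notMem_erase _ _ (hWA i h), hWl i⟩
  -- If two receivers request the same file, a permuted template could give both the same packet.
  -- Colouring the packets and asking for colour i + shift at position i excludes this, since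
  -- distinct positions get distinct colours; balance keeps the loss from rounding bounded.
  choose cl hcl using fun x : Fin N × Finset (Fin KR) => exists_balanced_colouring
    (patternSet U x.1 x.2) hKR
  let colour : Packet N F → Fin KR := fun w => cl (w.1, cachers U w) w.2
  let E : Equiv.Perm (Fin KR) × Fin KR →
      (Σ _ : Fin KR, Finset (Fin KR)) × Fin KR → Prop := fun σ t =>
    ∃ i ∈ A, mapPointed σ.1 ⟨i, W i⟩ = t.1 ∧ i + σ.2 = t.2
  let ty : Request KR N F → (Σ _ : Fin KR, Finset (Fin KR)) × Fin KR := fun r =>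
    (⟨r.1, cachers U r.2⟩, colour r.2)
  let D := (requests d U).filter fun r => (cachers U r.2).card = l
  have hcount : ∀ r ∈ D, ∃ T : Finset (Equiv.Perm (Fin KR) × Fin KR),
      min (m + l) KR * X l ≤ T.card ∧ ∀ σ ∈ T, E σ (ty r) := by
    intro r hr
    obtain ⟨hr1, hr2⟩ := Finset.mem_filter.mp hr
    have hpt : (ty r).1 ∈ pointedSets KR l := by
      rw [mem_pointedSets]
      exact ⟨fun hc => (mem_requests.mp hr1).2 (mem_cachers.mp hc), hr2⟩
    -- A type is met once for each position i in A and each of the X l permutations carrying (i, W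
    -- i) to it; its colour then fixes the shift.
    let T : Finset (Σ _ : Fin KR, Equiv.Perm (Fin KR)) :=
      A.sigma fun i => Finset.univ.filter fun σ => mapPointed σ ⟨i, W i⟩ = (ty r).1
    have hT : T.card = min (m + l) KR * X l := by
      rw [Finset.card_sigma, Finset.sum_congr rfl fun i _ => hXeq _ (hWpt i) _ hpt,
        Finset.sum_const, hA, smul_eq_mul, hn]
    refine ⟨T.image fun x => (x.2, (ty r).2 - x.1), ?_, ?_⟩
    · rw [← hT, Finset.card_image_of_injective]
      rintro ⟨i, σ⟩ ⟨i', σ'⟩ h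
      simp only [Prod.mk.injEq, sub_right_inj] at h
      rw [h.1, h.2]
    · intro σ hσ
      obtain ⟨⟨i, σ⟩, hx, rfl⟩ := Finset.mem_image.mp hσ
      obtain ⟨hi, hx2⟩ := Finset.mem_sigma.mp hx
      exact ⟨i, hi, (Finset.mem_filter.mp hx2).2, add_sub_cancel _ _⟩
  have hpop : ∀ r ∈ D, ∀ S ⊆ D, (∀ r' ∈ S, ty r' = ty r) → S.card ≤ M l / KR + 1 := by
    intro r hr S hSD hS
    obtain ⟨hr1, hr2⟩ := Finset.mem_filter.mp hr
    have hS' : ∀ r' ∈ S, (r'.1 = r.1 ∧ cachers U r'.2 = cachers U r.2) ∧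
        colour r'.2 = colour r.2 := by
      intro r' hr'
      have h1 := hS r' hr'
      simp only [ty, Prod.mk.injEq, Sigma.mk.injEq, heq_eq_eq] at h1
      exact h1
    obtain ⟨T, hT, hTS, hTr⟩ := exists_packets_of_requests
      (fun r' hr' => (Finset.mem_filter.mp (hSD hr')).1) (fun r' hr' => (hS' r' hr').1)
    rw [← hTS]
    refine (hcl (d r.1, cachers U r.2) (colour r.2) T hT fun f hf => ?_).trans ?_
    · obtain ⟨r', hr', h1⟩ := hTr f hf
      have h2 := (hS' r' hr').2
      rw [← h2, h1]
      simp only [colour]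
      rw [← h1, (hS' r' hr').1.2]
    · rw [← hr2]
      exact Nat.succ_le_succ (Nat.div_le_div_right (hM _ _))
  obtain ⟨B, hB, hcov⟩ := exists_pattern_cover D ty E
    (by rw [← hn]; exact Nat.mul_pos (by omega) hXpos) hcount hpop
  refine ⟨B, fun b => ?_, fun r hr hl => hcov r (Finset.mem_filter.mpr ⟨hr, hl⟩)⟩
  obtain ⟨hsub, hE, hinj⟩ := hB b
  have hmem : ∀ r ∈ B b, r ∈ requests d U ∧ (cachers U r.2).card = l :=
    fun r hr => Finset.mem_filter.mp (hsub hr)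
  have hE' : ∀ r ∈ B b, ∃ i ∈ A, b.1.1 i = r.1 ∧
      (W i).map b.1.1.toEmbedding = cachers U r.2 ∧ i + b.1.2 = colour r.2 := by
    intro r hr
    obtain ⟨i, hi, h1, h2⟩ := hE r hr
    simp only [mapPointed, ty, Sigma.mk.injEq, heq_eq_eq] at h1
    exact ⟨i, hi, h1.1, h1.2, h2⟩
  have hfst : Set.InjOn Prod.fst (B b : Set (Request KR N F)) := by
    intro r hr r' hr' h
    obtain ⟨i, -, h1, h2, h3⟩ := hE' r hr
    obtain ⟨i', -, h1', h2', h3'⟩ := hE' r' hr'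
    have hii : i = i' := b.1.1.injective (by rw [h1, h1', h])
    subst hii
    apply hinj hr hr'
    simp only [ty]
    rw [← h2, ← h2', ← h3, ← h3', h]
  have hsnd : Set.InjOn Prod.snd (B b : Set (Request KR N F)) := by
    intro r hr r' hr' h
    apply hfst hr hr'
    obtain ⟨i, -, h1, h2, h3⟩ := hE' r hr
    obtain ⟨i', -, h1', h2', h3'⟩ := hE' r' hr'
    rw [h, ← h3'] at h3
    rw [← h1, ← h1', add_right_cancel h3]
  refine ⟨hmem, hfst, hsnd, feasibleP_of_card hν
    (fun r hr => (mem_requests.mp (hmem r hr).1).2) hfst hsnd ?_⟩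
  intro r hr
  obtain ⟨i, -, -, h2, -⟩ := hE' r hr
  -- Scheduled receivers and cachers all lie in the image of A, so at most n - l ≤ m scheduled
  -- receivers, the destination included, do not cache the packet.
  have hL : cachers U r.2 ⊆ A.map b.1.1.toEmbedding := by
    rw [← h2]
    exact Finset.map_subset_map.mpr ((hWA i).trans (Finset.erase_subset _ _))
  have hS : (B b).image Prod.fst ⊆ A.map b.1.1.toEmbedding := by
    intro j hj
    obtain ⟨s, hs, rfl⟩ := Finset.mem_image.mp hj
    obtain ⟨i', hi', h1', -⟩ := hE' s hs
    rw [← h1']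
    exact Finset.mem_map_of_mem _ hi'
  have h3 := Finset.card_image_of_injOn hfst
  have h4 := Finset.card_sdiff_add_card_inter ((B b).image Prod.fst) (cachers U r.2)
  have h5 := Finset.card_le_card (Finset.sdiff_subset_sdiff hS (subset_refl (cachers U r.2)))
  rw [Finset.card_sdiff_of_subset hL, Finset.card_map, hA, (hmem r hr).2] at h5
  have h6 := hP r.2
  rw [Finset.inter_comm]
  omega

end Schedules

/-! ### Transmitter placement -/

section Placement

variable {KT KR N F : ℕ}

/-- Cyclic placement: every packet is cached at (at least) `m` transmitters and every transmitter
caches at most `a` packets. -/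
theorem exists_placement {m a : ℕ} (hmK : m ≤ KT) (h : KT * a = m * (N * F)) :
    ∃ P : Fin KT → Finset (Packet N F),
      (∀ i, (P i).card ≤ a) ∧ ∀ w, m ≤ (transmitters P w).card := by
  classical
  let p : Packet N F → ℕ := fun w => (finProdFinEquiv w : Fin (N * F))
  have hp : Function.Injective p := fun w w' h => finProdFinEquiv.injective (Fin.ext h)
  have hplt : ∀ w, p w < N * F := fun w => (finProdFinEquiv w).2
  refine ⟨fun i => Finset.univ.filter fun w => ∃ x < m, (m * p w + x) % KT = i, ?_, ?_⟩
  · intro i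
    -- Copies of the packets, m of each, are dealt consecutively around the transmitters, and q is
    -- the round in which transmitter i receives w. There are a rounds, and q and i give the
    -- position of the copy, which determines w on division by m.
    have hex : ∀ w : Packet N F, ∃ q : ℕ, (∃ x < m, (m * p w + x) % KT = i) →
        q < a ∧ ∃ x < m, m * p w + x = KT * q + i := by
      intro w
      by_cases hw : ∃ x < m, (m * p w + x) % KT = i
      · obtain ⟨x, hx, hxi⟩ := hw
        refine ⟨(m * p w + x) / KT, fun _ => ⟨?_, x, hx, ?_⟩⟩
        · rw [Nat.div_lt_iff_lt_mul i.pos, mul_comm a, h]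
          calc m * p w + x < m * (p w + 1) := by rw [mul_add, mul_one]; omega
            _ ≤ m * (N * F) := Nat.mul_le_mul_left _ (hplt w)
        · rw [← hxi, Nat.div_add_mod]
      · exact ⟨0, fun h => absurd h hw⟩
    choose q hq using hex
    rw [← Finset.card_range a]
    apply Finset.card_le_card_of_injOn q
    · intro w hw
      simp only [Finset.coe_range, Set.mem_Iio]
      exact (hq w (Finset.mem_filter.mp hw).2).1
    · intro w hw w' hw' hqq
      obtain ⟨-, x, hx, h1⟩ := hq w (Finset.mem_filter.mp hw).2
      obtain ⟨-, x', hx', h2⟩ := hq w' (Finset.mem_filter.mp hw').2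
      apply hp
      rw [hqq, ← h2] at h1
      have h3 := congrArg (· / m) h1
      simp only [Nat.mul_add_div (by omega : 0 < m), Nat.div_eq_of_lt hx,
        Nat.div_eq_of_lt hx'] at h3
      simpa using h3
  · intro w
    rcases Nat.eq_zero_or_pos KT with h0 | hKT
    · omega
    · conv_lhs => rw [← Finset.card_range m]
      apply Finset.card_le_card_of_injOn
        fun x => (⟨(m * p w + x) % KT, Nat.mod_lt _ hKT⟩ : Fin KT)
      · intro x hx
        rw [Finset.mem_coe, mem_transmitters]
        exact Finset.mem_filter.mpr
          ⟨Finset.mem_univ _, x, by simpa using hx, rfl⟩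
      · intro x hx x' hx' hxx
        simp only [Finset.coe_range, Set.mem_Iio] at hx hx'
        have h1 : m * p w + x ≡ m * p w + x' [MOD KT] := congrArg Fin.val hxx
        have h2 := Nat.ModEq.add_left_cancel' _ h1
        exact Nat.ModEq.eq_of_lt_of_lt h2 (by omega) (by omega)

end Placement

/-! ### Asymptotic block counts and the choice of parameters -/

section Asymptotics

/-- The limiting fraction of packets that are cached exactly at `l` given receivers. -/
noncomputable def levelProb (K : ℕ) (x : ℝ) (l : ℕ) : ℝ := x ^ l * (1 - x) ^ (K - l)

/-- Here K!/X = K C(K-1,l), and the K shifts cancel the division of M by K colours. The rounding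
errors cost a number of blocks independent of M, which is negligible as F grows. -/
theorem blocksP_le {K m l M : ℕ} (hm : 1 ≤ m) (hl : l < K) :
    (blocksP K m l M : ℝ) ≤ K * (K - 1).choose l / min ((m : ℝ) + l) K * M +
      2 * (K.factorial * K) := by
  set X : ℕ := K.factorial / (K * (K - 1).choose l) with hX
  have hXmul : X * (K * (K - 1).choose l) = K.factorial :=
    Nat.div_mul_cancel (mul_choose_dvd_factorial hl)
  have hXpos : 0 < X := Nat.pos_of_mul_pos_right (hXmul ▸ Nat.factorial_pos K)
  set n := min (m + l) K with hn
  have hnpos : 0 < n := by omega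
  have hncast : min ((m : ℝ) + l) K = n := by rw [hn]; push_cast; rfl
  have hK0 : (0 : ℝ) < K := by exact_mod_cast (by omega : 0 < K)
  have hX0 : (0 : ℝ) < X := by exact_mod_cast hXpos
  have hn0 : (0 : ℝ) < n := by exact_mod_cast hnpos
  have hXr : (X : ℝ) * (K * (K - 1).choose l) = K.factorial := by exact_mod_cast hXmul
  have hnX : (1 : ℝ) ≤ n * X := by exact_mod_cast Nat.mul_pos hnpos hXpos
  rw [hncast]
  have h1 : (((M / K + 1) / (n * X) + 1 : ℕ) : ℝ) ≤ (M / K + 1) / (n * X) + 1 := by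
    push_cast
    gcongr
    refine Nat.cast_div_le.trans ?_
    push_cast
    gcongr
    exact Nat.cast_div_le
  calc (blocksP K m l M : ℝ) = K.factorial * K * (((M / K + 1) / (n * X) + 1 : ℕ) : ℝ) := by
        unfold blocksP
        rw [← hX, ← hn]
        push_cast
        rfl
    _ ≤ K.factorial * K * ((M / K + 1) / (n * X) + 1) := by gcongr
    _ = K.factorial / (n * X) * M + K.factorial * K * (1 / (n * X)) + K.factorial * K := by
        field_simp
    _ ≤ K * (K - 1).choose l / n * M + K.factorial * K * 1 + K.factorial * K := by
        have h2 : (K.factorial : ℝ) / (n * X) = K * (K - 1).choose l / n := by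
          rw [← hXr]
          field_simp
        have h3 : 1 / ((n : ℝ) * X) ≤ 1 := (div_le_one (by positivity)).mpr hnX
        rw [h2]
        gcongr
    _ = _ := by ring

/-- The limit of the number of P-blocks divided by F: the requests per F, K(1-x), times the mean
reciprocal block size. -/
theorem sum_weightsP {k : ℕ} (M x : ℝ) :
    ∑ l : Fin (k + 1), ((k : ℝ) + 1) * k.choose l / min (M + l) ((k : ℝ) + 1) *
      levelProb (k + 1) x l = ((k : ℝ) + 1) * (1 - x) * meanInvSize k M x := by
  rw [Fin.sum_univ_eq_sum_range fun l => ((k : ℝ) + 1) * k.choose l /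
    min (M + l) ((k : ℝ) + 1) * levelProb (k + 1) x l, meanInvSize, Finset.mul_sum]
  refine Finset.sum_congr rfl fun l hl => ?_
  have : k + 1 - l = (k - l) + 1 := by have := Finset.mem_range.mp hl; omega
  rw [levelProb, this, pow_succ]
  ring

/-- The N-counterpart: the sum is the limit of the number of N-blocks divided by F, and its
prefactor is the resulting mean block size. -/
theorem sum_weightsN {k : ℕ} {x : ℝ} (hx0 : 0 ≤ x) (hx1 : x < 1) :
    (if x = 0 then 1 else ((k : ℝ) + 1) * x / (1 - (1 - x) ^ (k + 1))) *
      ∑ l : Fin (k + 1), ((k + 1).choose (l + 1) : ℝ) * levelProb (k + 1) x l =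
      ((k : ℝ) + 1) * (1 - x) := by
  rw [Fin.sum_univ_eq_sum_range fun l => ((k + 1).choose (l + 1) : ℝ) * levelProb (k + 1) x l]
  split_ifs with h0
  · subst h0
    rw [Finset.sum_eq_single 0]
    · simp [levelProb]
    · intro l _ hl
      simp [levelProb, hl]
    · simp
  · have hx : 0 < x := lt_of_le_of_ne hx0 (Ne.symm h0)
    have hp : (1 - x) ^ (k + 1) < 1 := pow_lt_one₀ (by linarith) (by linarith) (by omega)
    have hsum : x * ∑ l ∈ Finset.range (k + 1), ((k + 1).choose (l + 1) : ℝ) *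
        levelProb (k + 1) x l = (1 - x) * (1 - (1 - x) ^ (k + 1)) := by
      rw [← binomial_sum_succ, Finset.mul_sum, Finset.mul_sum]
      refine Finset.sum_congr rfl fun l hl => ?_
      have : k + 1 - l = (k - l) + 1 := by have := Finset.mem_range.mp hl; omega
      rw [levelProb, this, pow_succ]
      ring
    have hne : 1 - (1 - x) ^ (k + 1) ≠ 0 := by linarith
    rw [div_mul_eq_mul_div, mul_assoc, hsum]
    field_simp

theorem tendsto_levelProb_floor (K : ℕ) {x : ℝ} (hx : 0 ≤ x) (l : ℕ) :
    Tendsto (fun F : ℕ => levelProb K ((⌊x * F⌋₊ : ℝ) / F) l) atTop (𝓝 (levelProb K x l)) := by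
  have h1 : Tendsto (fun F : ℕ => (⌊x * F⌋₊ : ℝ) / F) atTop (𝓝 x) :=
    (tendsto_nat_floor_mul_div_atTop hx).comp tendsto_natCast_atTop_atTop
  exact (h1.pow l).mul ((tendsto_const_nhds.sub h1).pow (K - l))

theorem eventually_weighted_le {K : ℕ} {x : ℝ} (hx : 0 ≤ x) (w : Fin K → ℝ) (C : ℝ) {η e : ℝ}
    (hη : (∑ l, w l) * η < e) :
    ∀ᶠ F : ℕ in atTop,
      ∑ l, w l * (F * (levelProb K ((⌊x * F⌋₊ : ℝ) / F) l + η)) + C ≤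
        F * (∑ l, w l * levelProb K x l + e) := by
  have hlim : Tendsto (fun F : ℕ =>
      ∑ l, w l * (levelProb K ((⌊x * F⌋₊ : ℝ) / F) l + η) + C / F) atTop
      (𝓝 (∑ l, w l * (levelProb K x l + η) + 0)) := by
    refine Tendsto.add (tendsto_finsetSum _ fun l _ => ?_) (tendsto_const_div_atTop_nhds_zero_nat C)
    exact ((tendsto_levelProb_floor K hx l).add_const η).const_mul _
  have hlt : ∑ l, w l * (levelProb K x l + η) + 0 < ∑ l, w l * levelProb K x l + e := by
    simp only [mul_add, Finset.sum_add_distrib, ← Finset.sum_mul]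
    linarith
  filter_upwards [hlim.eventually_lt_const hlt, eventually_gt_atTop 0] with F h1 hF
  have hF0 : (0 : ℝ) < F := by exact_mod_cast hF
  refine le_trans (le_of_eq ?_) (mul_le_mul_of_nonneg_left h1.le hF0.le)
  rw [mul_add, Finset.mul_sum]
  congr 1
  · exact Finset.sum_congr rfl fun l _ => by ring
  · field_simp

variable {KT KR N F : ℕ}

theorem patternProb_eq (k : ℕ) (L : Finset (Fin KR)) :
    patternProb F k L = levelProb KR ((k : ℝ) / F) L.card := rfl

theorem card_requests_cacheOf {μR : ℝ} (hμ0 : 0 ≤ μR) {s : Fin KR → Fin N → Finset (Fin F)}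
    (hs : s ∈ receiverChoices KR N F μR) (d : Fin KR → Fin N) :
    KR * (1 - μR) * F ≤ ((requests d (cacheOf s)).card : ℝ) := by
  classical
  have hcard : ∀ j n, (s j n).card = ⌊μR * F⌋₊ := by
    intro j n
    have h1 := Fintype.mem_piFinset.mp (Fintype.mem_piFinset.mp hs j) n
    exact (Finset.mem_powersetCard.mp h1).2
  let T : Finset (Σ _ : Fin KR, Fin F) := Finset.univ.sigma fun j => (s j (d j))ᶜ
  have hT : T.card ≤ (requests d (cacheOf s)).card := by
    apply Finset.card_le_card_of_injOn fun x => (x.1, (d x.1, x.2))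
    · rintro ⟨j, f⟩ hx
      simp only [T, Finset.mem_coe, Finset.mem_sigma, Finset.mem_univ, true_and,
        Finset.mem_compl] at hx
      simp [mem_requests, cacheOf, hx]
    · rintro ⟨j, f⟩ - ⟨j', f'⟩ - h
      simp only [Prod.mk.injEq] at h
      rw [h.1, h.2.2]
  have hTc : (T.card : ℝ) = KR * (F - ⌊μR * F⌋₊) := by
    simp only [T, Finset.card_sigma, Finset.card_compl, hcard, Fintype.card_fin, Finset.sum_const,
      Finset.card_univ, smul_eq_mul, Nat.cast_mul]
    rcases Nat.eq_zero_or_pos KR with h | h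
    · simp [h]
    · let j : Fin KR := ⟨0, h⟩
      rw [Nat.cast_sub]
      rw [← hcard j (d j)]
      simpa using Finset.card_le_univ (s j (d j))
  calc KR * (1 - μR) * F = KR * (F - μR * F) := by ring
    _ ≤ KR * (F - ⌊μR * F⌋₊) := by
        gcongr
        exact Nat.floor_le (by positivity)
    _ ≤ _ := by rw [← hTc]; exact_mod_cast hT

/-- This q makes q/α = a/c and (1-q)/(1-α) = b/c, which balances the subchannels. One without
bandwidth carries nothing, and 0/0 = 0 applies. -/
theorem deliveryTime_le {α q c a b T : ℝ} {Hp Hn : ℕ} (hα0 : 0 ≤ α) (hα1 : α ≤ 1) (ha : 0 < a)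
    (hb : 0 < b) (hc : c = α * a + (1 - α) * b) (hc0 : 0 < c) (hq : q = α * a / c)
    (hp : a * Hp ≤ c * T) (hn : b * Hn ≤ c * T) :
    deliveryTime α q Hp Hn ≤ ENNReal.ofReal T := by
  have aux : ∀ {β y : ℝ} {H : ℕ}, 0 ≤ β → 0 < y → y * H ≤ c * T →
      ENNReal.ofReal (β * y / c) / ENNReal.ofReal β * H ≤ ENNReal.ofReal T := by
    intro β y H hβ hy h
    rcases hβ.eq_or_lt with h0 | h0
    · subst h0; simp
    · rw [← ENNReal.ofReal_div_of_pos h0, ← ENNReal.ofReal_natCast, ← ENNReal.ofReal_mul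
        (by positivity)]
      apply ENNReal.ofReal_le_ofReal
      have : β * y / c / β * H = y * H / c := by field_simp
      rw [this, div_le_iff₀ hc0]
      linarith
  refine max_le ?_ ?_
  · rw [hq]; exact aux hα0 ha hp
  · have : 1 - q = (1 - α) * b / c := by
      rw [hq, hc]
      have : α * a + (1 - α) * b ≠ 0 := by rw [← hc]; exact hc0.ne'
      field_simp
      ring
    rw [this]; exact aux (by linarith) hb hn

theorem ofReal_le_card_div {n : ℕ} {t : ℝ≥0∞} {x T : ℝ} (hn : n ≠ 0) (hT : 0 ≤ T)
    (ht : t ≤ ENNReal.ofReal T) (h : x * T ≤ n) : ENNReal.ofReal x ≤ (n : ℝ≥0∞) / t := by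
  rw [ENNReal.le_div_iff_mul_le (Or.inr (by exact_mod_cast hn)) (Or.inr (ENNReal.natCast_ne_top n))]
  calc ENNReal.ofReal x * t ≤ ENNReal.ofReal x * ENNReal.ofReal T := by gcongr
    _ = ENNReal.ofReal (x * T) := (ENNReal.ofReal_mul' hT).symm
    _ ≤ ENNReal.ofReal n := ENNReal.ofReal_le_ofReal h
    _ = n := ENNReal.ofReal_natCast n

/-- If all cache patterns are about as frequent as expected, the realization attains nearly the
DoF of decentralized placement. -/
theorem le_realizationDoF_cacheOf {k : ℕ} {νp νn : Measure (Channel KT (k + 1))}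
    (hνp : νp ≪ volume)
    (hνn : νn ≪ volume) {P : Fin KT → Finset (Packet N F)} {m : ℕ} (hm : 1 ≤ m)
    (hP : ∀ w, m ≤ (transmitters P w).card) {μR α : ℝ} (hμR0 : 0 ≤ μR)
    (hα0 : 0 ≤ α) (hα1 : α ≤ 1) {a b c q G e x η : ℝ} (ha : 0 < a)
    (hb : 0 < b) (hc : c = α * a + (1 - α) * b) (hc0 : 0 < c) (hq : q = α * a / c)
    (hG : G = ((k : ℝ) + 1) * (1 - μR)) (hη : 0 ≤ η)
    (hGe : 0 ≤ G + (a + b) * e) (he : 0 ≤ e) (hx : x * (G + (a + b) * e) ≤ c * G)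
    (hbp : a * (∑ l : Fin (k + 1), ((k : ℝ) + 1) * k.choose l / min ((m : ℝ) + l) ((k : ℝ) + 1) *
      (F * (levelProb (k + 1) ((⌊μR * F⌋₊ : ℝ) / F) l + η)) +
        (k + 1) * (2 * ((k + 1).factorial * ((k : ℝ) + 1)))) ≤ F * (G + a * e))
    (hbn : b * (∑ l : Fin (k + 1), ((k + 1).choose (l + 1) : ℝ) *
      (F * (levelProb (k + 1) ((⌊μR * F⌋₊ : ℝ) / F) l + η)) +
        ∑ l : Fin (k + 1), ((k + 1).choose (l + 1) : ℝ)) ≤ F * (G + b * e))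
    (hμ : ⌊μR * F⌋₊ ≤ F)
    {s : Fin (k + 1) → Fin N → Finset (Fin F)} (hs : s ∈ receiverChoices (k + 1) N F μR)
    (hgood : ∀ n L, (patternCount (cacheOf s) n L : ℝ) ≤
      F * (patternProb F ⌊μR * F⌋₊ L + η)) :
    ENNReal.ofReal x ≤ realizationDoF α νp νn P (cacheOf s) q := by
  let M : ℕ → ℕ := fun l => ⌊F * (levelProb (k + 1) ((⌊μR * F⌋₊ : ℝ) / F) l + η)⌋₊
  have hpos : ∀ l, 0 ≤ F * (levelProb (k + 1) ((⌊μR * F⌋₊ : ℝ) / F) l + η) := by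
    intro l
    have h1 : (⌊μR * F⌋₊ : ℝ) / F ≤ 1 :=
      div_le_one_of_le₀ (by exact_mod_cast hμ) (Nat.cast_nonneg _)
    have h2 : (0 : ℝ) ≤ 1 - (⌊μR * F⌋₊ : ℝ) / F := by linarith
    unfold levelProb
    positivity
  have hMle : ∀ l, (M l : ℝ) ≤ F * (levelProb (k + 1) ((⌊μR * F⌋₊ : ℝ) / F) l + η) :=
    fun l => Nat.floor_le (hpos l)
  have hM : ∀ n L, patternCount (cacheOf s) n L ≤ M L.card := by
    intro n L
    apply Nat.le_floor
    have := hgood n L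
    rwa [patternProb_eq] at this
  refine le_iInf₂ fun d hd => ?_
  obtain ⟨Bp, hBp⟩ := exists_scheduleP hνp hm hP (d := d) hM
  obtain ⟨Bn, hBn⟩ := exists_scheduleN hνn
    (fun w => Finset.card_pos.mp (lt_of_lt_of_le hm (hP w))) (d := d) hM
  refine le_trans ?_ (le_iSup_of_le _ (le_iSup_of_le _ (le_iSup_of_le Bp (le_iSup_of_le Bn
    (le_iSup_of_le hBp (le_iSup_of_le hBn le_rfl))))))
  have hF0 : (0 : ℝ) ≤ F := Nat.cast_nonneg _
  -- T is the ideal time F G / c, enlarged to absorb the slack e of both subchannels.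
  refine ofReal_le_card_div (T := F * (G + (a + b) * e) / c) hd.card_pos.ne' (by positivity)
    (deliveryTime_le hα0 hα1 ha hb hc hc0 hq ?_ ?_) ?_
  · rw [mul_div_cancel₀ _ hc0.ne']
    have h1 : F * (G + a * e) ≤ F * (G + (a + b) * e) := by
      have : 0 ≤ b * e := by positivity
      gcongr
      linarith
    refine le_trans (mul_le_mul_of_nonneg_left ?_ ha.le) (hbp.trans h1)
    push_cast
    calc ∑ l : Fin (k + 1), (blocksP (k + 1) m l (M l) : ℝ) ≤
        ∑ l : Fin (k + 1), (((k : ℝ) + 1) * k.choose l / min ((m : ℝ) + l) ((k : ℝ) + 1) *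
          (F * (levelProb (k + 1) ((⌊μR * F⌋₊ : ℝ) / F) l + η)) +
          2 * ((k + 1).factorial * ((k : ℝ) + 1))) := by
          refine Finset.sum_le_sum fun l _ => ?_
          have h2 := blocksP_le (M := M l) hm l.2
          push_cast at h2
          refine h2.trans ?_
          have h3 : (0 : ℝ) ≤ min ((m : ℝ) + l) ((k : ℝ) + 1) := by positivity
          gcongr
          exact hMle l
      _ = _ := by
          rw [Finset.sum_add_distrib]
          simp
  · rw [mul_div_cancel₀ _ hc0.ne']
    have h1 : F * (G + b * e) ≤ F * (G + (a + b) * e) := by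
      have : 0 ≤ a * e := by positivity
      gcongr
      linarith
    refine le_trans (mul_le_mul_of_nonneg_left ?_ hb.le) (hbn.trans h1)
    push_cast
    rw [← Finset.sum_add_distrib]
    refine Finset.sum_le_sum fun l _ => ?_
    have h2 := mul_le_mul_of_nonneg_left (hMle l)
      (Nat.cast_nonneg ((k + 1).choose (l + 1)) : (0 : ℝ) ≤ _)
    linarith
  · have h1 := card_requests_cacheOf hμR0 hs d
    refine le_trans ?_ h1
    push_cast
    rw [← hG]
    have h2 := mul_le_mul_of_nonneg_left hx hF0
    rw [mul_div_assoc', div_le_iff₀ hc0]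
    linarith

theorem decentralizedAchievable {k : ℕ} {μT μR α : ℝ} (hμT : μT ≤ 1) (hlib : 1 ≤ (KT : ℝ) * μT)
    (hint : ∃ m : ℕ, (KT : ℝ) * μT = m) (hμR0 : 0 ≤ μR) (hμR1 : μR < 1) (hα0 : 0 ≤ α) (hα1 : α ≤ 1)
    {νp νn : Measure (Channel KT (k + 1))} (hνp : νp ≪ volume) (hνn : νn ≪ volume) :
    DecentralizedAchievable KT (k + 1) N μT μR α νp νn
      (decentralizedDoF KT (k + 1) μT μR α) := by
  classical
  obtain ⟨m, hm⟩ := hint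
  have hm1 : 1 ≤ m := by rw [hm] at hlib; exact_mod_cast hlib
  have hKT0 : (0 : ℝ) ≤ KT := Nat.cast_nonneg _
  have hmK : m ≤ KT := by
    have : (m : ℝ) ≤ KT := by rw [← hm]; nlinarith
    exact_mod_cast this
  have hμT0 : 0 ≤ μT := by
    by_contra! h
    nlinarith
  set E := meanInvSize k (KT * μT) μR with hE
  have hEpos : 0 < E := meanInvSize_pos hlib hμR0 hμR1
  set a := 1 / E with ha'
  have ha : 0 < a := by positivity
  set b : ℝ := if μR = 0 then 1 else ((k : ℝ) + 1) * μR / (1 - (1 - μR) ^ (k + 1)) with hb'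
  have hb : 0 < b := by
    have h1 := one_add_le_three_mul (k := k) hμR0 hμR1
    have h2 : 0 ≤ ((k : ℝ) + 1) * μR := by positivity
    rw [← hb'] at h1
    linarith
  set c := decentralizedDoF KT (k + 1) μT μR α with hcdef
  have hc : c = α * a + (1 - α) * b := decentralizedDoF_eq KT k μT μR α
  have hc0 : 0 < c := by
    rcases hα0.eq_or_lt with h | h
    · rw [hc, ← h]; linarith
    · have : 0 ≤ (1 - α) * b := mul_nonneg (by linarith) hb.le
      have : 0 < α * a := mul_pos h ha
      linarith
  have hq0 : 0 ≤ α * a / c := by positivity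
  have hq1 : α * a / c ≤ 1 := by
    rw [div_le_one hc0, hc]
    have : 0 ≤ (1 - α) * b := mul_nonneg (by linarith) hb.le
    linarith
  refine ⟨α * a / c, hq0, hq1, ?_⟩
  have hex : ∀ F : ℕ, ∃ P : Fin KT → Finset (Packet N F),
      (∀ i, ((P i).card : ℝ) ≤ μT * N * F) ∧
      ((∃ y : ℕ, μT * N * F = y) → ∀ w, m ≤ (transmitters P w).card) := by
    intro F
    by_cases hF : ∃ y : ℕ, μT * N * F = y
    · obtain ⟨y, hy⟩ := hF
      have h1 : KT * y = m * (N * F) := by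
        have : (KT : ℝ) * y = m * (N * F) := by rw [← hy, ← hm]; ring
        exact_mod_cast this
      obtain ⟨P, hP1, hP2⟩ := exists_placement hmK h1
      exact ⟨P, fun i => by rw [hy]; exact_mod_cast hP1 i, fun _ => hP2⟩
    -- These F lie outside the limit, so any placement within the memory size will do.
    · refine ⟨fun _ => ∅, fun i => ?_, fun h => absurd h hF⟩
      simp only [Finset.card_empty, Nat.cast_zero]
      positivity
  choose P hPc hPm using hex
  refine ⟨P, hPc, fun ε hε => ?_⟩
  set G := ((k : ℝ) + 1) * (1 - μR) with hG
  have hGpos : 0 < G := mul_pos (by positivity) (by linarith)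
  -- The slack e in the block counts may cost at most ε in the DoF: (c-ε)(G+(a+b)e) ≤ cG follows.
  obtain ⟨e, he, hee⟩ : ∃ e > 0, c * ((a + b) * e) ≤ ε * G :=
    ⟨ε * G / (c * (a + b)), by positivity, le_of_eq (by field_simp)⟩
  let wP : Fin (k + 1) → ℝ := fun l =>
    ((k : ℝ) + 1) * k.choose l / min ((m : ℝ) + l) ((k : ℝ) + 1)
  let wN : Fin (k + 1) → ℝ := fun l => ((k + 1).choose (l + 1) : ℝ)
  have hwP : 0 ≤ ∑ l, wP l := Finset.sum_nonneg fun l _ => by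
    have : (0 : ℝ) ≤ min ((m : ℝ) + l) ((k : ℝ) + 1) := by positivity
    positivity
  have hwN : 0 ≤ ∑ l, wN l := Finset.sum_nonneg fun l _ => by positivity
  -- This deviation of the pattern frequencies keeps both weighted sums of errors strictly below e,
  -- which leaves room for the additive constants.
  let η := e / (∑ l, wP l + ∑ l, wN l + 1)
  have hη : 0 < η := by positivity
  have hηe : (∑ l, wP l + ∑ l, wN l + 1) * η = e := by
    simp only [η]
    field_simp
  have hevP := eventually_weighted_le hμR0 wP
    ((k + 1) * (2 * ((k + 1).factorial * ((k : ℝ) + 1)))) (η := η) (e := e) (by nlinarith)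
  have hevN := eventually_weighted_le hμR0 wN (∑ l, wN l) (η := η) (e := e) (by nlinarith)
  have hsumP : a * ∑ l, wP l * levelProb (k + 1) μR l = G := by
    have h1 := sum_weightsP (k := k) (m : ℝ) μR
    rw [← hm, ← hE] at h1
    simp only [wP]
    rw [← hm, h1, ha', hG]
    field_simp
  have hsumN : b * ∑ l, wN l * levelProb (k + 1) μR l = G := sum_weightsN hμR0 hμR1
  have hlow : Tendsto (fun F : ℕ => 1 - N * 2 ^ (k + 1) / (η ^ 2 * F))
      (atTop ⊓ 𝓟 {F : ℕ | ∃ y : ℕ, μT * N * F = y}) (𝓝 (1 : ℝ)) := by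
    have h1 : Tendsto (fun F : ℕ => (1 : ℝ) - (N * 2 ^ (k + 1) / η ^ 2) / F) atTop
        (𝓝 (1 - 0)) := tendsto_const_nhds.sub (tendsto_const_div_atTop_nhds_zero_nat _)
    rw [sub_zero] at h1
    refine (h1.congr fun F => ?_).mono_left inf_le_left
    rw [div_div]
  refine tendsto_of_tendsto_of_tendsto_of_le_of_le' hlow tendsto_const_nhds ?_
    (Eventually.of_forall fun F => decentralizedProb_le_one _ _)
  rw [eventually_inf_principal]
  filter_upwards [hevP, hevN, eventually_ge_atTop 1] with F hFP hFN hF1 hFS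
  have hμ : ⌊μR * F⌋₊ ≤ F := by
    apply Nat.floor_le_of_le
    nlinarith [(Nat.cast_nonneg F : (0 : ℝ) ≤ F)]
  refine le_decentralizedProb hμ hF1 hη fun s hs hgood => ?_
  refine le_realizationDoF_cacheOf hνp hνn hm1 (hPm F hFS) hμR0 hα0 hα1 ha hb hc hc0 rfl hG hη.le
    (e := e) (by positivity) he.le ?_ ?_ ?_ hμ hs hgood
  · have h1 : 0 ≤ ε * ((a + b) * e) := by positivity
    have h2 : (c - ε) * (G + (a + b) * e) =
        c * G - ε * G + c * ((a + b) * e) - ε * ((a + b) * e) := by ring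
    rw [h2]
    linarith only [h1, hee]
  · refine (mul_le_mul_of_nonneg_left hFP ha.le).trans (le_of_eq ?_)
    rw [← hsumP]; ring
  · refine (mul_le_mul_of_nonneg_left hFN hb.le).trans (le_of_eq ?_)
    rw [← hsumN]; ring

end Asymptotics

end CacheNet

theorem theorem2 (KT KR N : ℕ) (hKR : 1 ≤ KR) (hN : 1 ≤ N)
    (μT μR α : ℝ) (hμT : μT ≤ 1) (hlib : 1 ≤ (KT : ℝ) * μT)
    (hint : ∃ m : ℕ, (KT : ℝ) * μT = m)
    (hμR0 : 0 ≤ μR) (hμR1 : μR < 1) (hα0 : 0 ≤ α) (hα1 : α ≤ 1)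
    (νp νn : MeasureTheory.Measure (CacheNet.Channel KT KR))
    [MeasureTheory.IsProbabilityMeasure νp] [MeasureTheory.IsProbabilityMeasure νn]
    (hνp : νp ≪ MeasureTheory.volume) (hνn : νn ≪ MeasureTheory.volume) :
    CacheNet.DecentralizedAchievable KT KR N μT μR α νp νn
        (CacheNet.decentralizedDoF KT KR μT μR α) ∧
      ∀ F : ℕ, 1 ≤ F →
        (1 / 3 : ENNReal) * CacheNet.networkDoF KT KR N F μT μR α νp νn ≤
          ENNReal.ofReal (CacheNet.decentralizedDoF KT KR μT μR α) := by
  refine ⟨?_, fun F hF =>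
    CacheNet.networkDoF_le hνp hνn hKR hlib hμR0 hμR1 hα0 hα1 hN hF⟩
  obtain ⟨k, rfl⟩ : ∃ k, KR = k + 1 := ⟨KR - 1, by omega⟩
  exact CacheNet.decentralizedAchievable hμT hlib hint hμR0 hμR1 hα0 hα1 hνp hνn
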